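/- There is an absolute constant $\delta>0$ such that the following holds. Let $G=(L\cup R,E)$ be a finite bipartite graph, $|L|=n$, in which every edge $e$ has a utility $v(e)>0$ and every left vertex $\ell$ has a bid $c(\ell)\ge 0$; let $C>0$ be a budget, and write $b(e)=c(\ell)/v(e)$ for $e=(\ell,r)$ and $v(M)=\sum_{e\in M}v(e)$ for $M\subseteq E$. Fix an order of the edges by decreasing utility, ties being broken arbitrarily. Assume that edges with different left endpoints have different values of $b$ (left vertices with bid $0$ excepted). Let $v(\mathrm{OPT}(C))$ be the largest $v(M)$ over matchings $M\subseteq E$ with $\sum_{(\ell,r)\in M}c(\ell)\le C$, and assume the large market condition $\max_{e\in E}v(e)\le\delta\, v(\mathrm{OPT}(C))$. For $S\subseteq L$ and $\gamma\in\mathbb R$ let $G_S(\gamma)$ be the graph of the edges $e$ with left endpoint in $S$ and $b(e)\le\gamma$; let $\mathrm{Greedy}(H)$ be the matching obtained by going through the edges of $H$ in the fixed order and taking each edge that keeps the set a matching. Let $\mathcal A(S)=\{\gamma:\gamma\, v(\mathrm{Greedy}(G_S(\gamma)))\le C\}$. An edge $e\in E$ survives (for the sample $S$) if $b(e)\le\gamma$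 for some $\gamma\in\mathcal A(S)$; when $\gamma'=\max\mathcal A(S)$ exists, this means $b(e)\le\gamma'$. Consider the following online algorithm (ON-truth without the bid condition $c(\ell)\le\mathrm{cost}(r)$). The left vertices arrive in a uniformly random order, and independently $k\sim\mathrm{Binomial}(n,1/2)$. The first $k$ arrivals form the sample $L'$. Let $M_1$ be the greedy matching of the surviving edges with left endpoint in $L'$; put $\mathrm{reward}(r)=v(e)$ if $e\in M_1$ is incident to $r$, and $\mathrm{reward}(r)=0$ if $r$ is unmatched in $M_1$. Start with $M=\emptyset$. When a later left vertex $\ell$ arrives, let $e^\star=(\ell,r)$ be the first edge, in the fixed order, among the surviving edges $(\ell,r)$ at $\ell$ with $v(\ell,r)\ge\mathrm{reward}(r)$, where in case of equality with the utility of the edge of $M_1$ at $r$ the edge $(\ell,r)$ is moreover required to precede that edge in the fixed order; if $e^\star$ exists and $M\cup\{e^\star\}$ is a matching, add $e^\star$ to $M$. Then the final matching $M$ satisfies $$\mathbb E[v(M)]\ \ge\ \frac{v(\mathrm{OPT}(C))}{12}.$$ -/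

import Mathlib

/-- A bipartite market with left vertices `Fin n` (the strategic users, who arrive online), right
vertices `Fin m`, edge set `edges`, a utility `v e > 0` on every edge and a bid `c ℓ ≥ 0` of every
left vertex.  The edges are listed in decreasing order of utility; where utilities coincide the
list records an (arbitrary) order in which ties are broken. -/
structure Market (n m : ℕ) where
  edges : List (Fin n × Fin m)
  nodup : edges.Nodup
  v : Fin n × Fin m → ℝ
  v_pos : ∀ e ∈ edges, 0 < v e
  sorted : edges.Pairwise (fun e f => v f ≤ v e)
  c : Fin n → ℝ
  c_nonneg : ∀ l, 0 ≤ c l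

namespace Market

/-- `e` shares no endpoint with an edge of `M` (so `M ∪ {e}` is a matching if `M` is one and
`e ∉ M`). -/
def Fits {n m : ℕ} (M : Finset (Fin n × Fin m)) (e : Fin n × Fin m) : Prop :=
  ∀ f ∈ M, f.1 ≠ e.1 ∧ f.2 ≠ e.2

/-- No two different edges of `M` share an endpoint. -/
def IsMatching {n m : ℕ} (M : Finset (Fin n × Fin m)) : Prop :=
  ∀ e ∈ M, ∀ f ∈ M, e ≠ f → e.1 ≠ f.1 ∧ e.2 ≠ f.2

open scoped Classical in
/-- Add `e` to the matching `M` if the result is a matching. -/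
noncomputable def addEdge {n m : ℕ} (M : Finset (Fin n × Fin m)) (e : Fin n × Fin m) :
    Finset (Fin n × Fin m) :=
  if Fits M e then insert e M else M

/-- Greedy matching: go through the edges in the order of the list (decreasing utility) and take
every edge that fits. -/
noncomputable def greedy {n m : ℕ} (l : List (Fin n × Fin m)) : Finset (Fin n × Fin m) :=
  l.foldl addEdge ∅

section

variable {n m : ℕ} (G : Market n m)

/-- The total utility of a set of edges. -/
noncomputable def value (M : Finset (Fin n × Fin m)) : ℝ := ∑ e ∈ M, G.v e

/-- Buck per bang `b(e) = c(ℓ) / v(e)` of an edge `e = (ℓ, r)`. -/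
noncomputable def bpb (e : Fin n × Fin m) : ℝ := G.c e.1 / G.v e

open scoped Classical in
/-- The value `v(OPT(C))`: the largest utility of a matching of total bid at most `C`. -/
noncomputable def opt (C : ℝ) : ℝ :=
  sSup (G.value '' {M | (∀ e ∈ M, e ∈ G.edges) ∧ IsMatching M ∧ ∑ e ∈ M, G.c e.1 ≤ C})

open scoped Classical in
/-- The edges of the subgraph `G'(γ)`: those whose left endpoint lies in `S` and whose buck per
bang is at most `γ`. -/
noncomputable def subEdges (S : Finset (Fin n)) (γ : ℝ) : List (Fin n × Fin m) :=
  G.edges.filter (fun e => e.1 ∈ S ∧ G.bpb e ≤ γ)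

/-- The set `𝒜(G')` of admissible thresholds for the subgraph `G'` on the left vertices `S`. -/
def admissible (C : ℝ) (S : Finset (Fin n)) : Set ℝ :=
  {γ | ∑ e ∈ greedy (G.subEdges S γ), γ * G.v e ≤ C}

/-- `e` survives the pruning at the threshold `γ' = max 𝒜(G')`, that is, `b(e) ≤ γ'`.
It is written so that it makes sense whether or not the supremum of `𝒜(G')` is attained or finite:
the surviving edges are those of the union of the graphs `G(γ)`, `γ ∈ 𝒜(G')`
(see `survives_iff`). -/
def Survives (C : ℝ) (S : Finset (Fin n)) (e : Fin n × Fin m) : Prop :=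
  ∃ γ ∈ G.admissible C S, G.bpb e ≤ γ

/-- If the maximum `γ'` of `𝒜(G')` exists, the surviving edges are those with `b(e) ≤ γ'`. -/
theorem survives_iff {C : ℝ} {S : Finset (Fin n)} {γ' : ℝ}
    (h : IsGreatest (G.admissible C S) γ') (e : Fin n × Fin m) :
    G.Survives C S e ↔ G.bpb e ≤ γ' :=
  ⟨fun ⟨_, hγ, hb⟩ => hb.trans (h.2 hγ), fun hb => ⟨γ', h.1, hb⟩⟩

open scoped Classical in
/-- The matching `M₁` returned by `Threshold` on the subgraph with left vertices `S` and budget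
`C`. -/
noncomputable def thresholdMatching (C : ℝ) (S : Finset (Fin n)) : Finset (Fin n × Fin m) :=
  greedy (G.edges.filter (fun e => e.1 ∈ S ∧ G.Survives C S e))

open scoped Classical in
/-- `reward(r)`: the utility of the edge of `M₁` at `r`, and `0` if `r` is unmatched in `M₁`. -/
noncomputable def reward (C : ℝ) (S : Finset (Fin n)) (r : Fin m) : ℝ :=
  ∑ f ∈ (G.thresholdMatching C S).filter (fun f => f.2 = r), G.v f

/-- The test `v(e) ≥ reward(r)` for an edge `e = (ℓ, r)`; if `v(e)` equals the utility of the edge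
of `M₁` at `r`, the tie is decided by the fixed order of the edges. -/
def MeetsReward (C : ℝ) (S : Finset (Fin n)) (e : Fin n × Fin m) : Prop :=
  G.reward C S e.2 ≤ G.v e ∧
    ∀ f ∈ G.thresholdMatching C S, f.2 = e.2 → G.v f = G.v e →
      G.edges.idxOf e < G.edges.idxOf f

open scoped Classical in
/-- The edge `e⋆` of the arriving left vertex `ℓ`: the one of largest utility (the first in the
list) among its edges that survive the pruning and meet the reward of their right vertex. -/
noncomputable def bestEdge (C : ℝ) (S : Finset (Fin n)) (l : Fin n) : Option (Fin n × Fin m) :=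
  G.edges.find? (fun e => e.1 = l ∧ G.Survives C S e ∧ G.MeetsReward C S e)

/-- One step of the decision phase: `ℓ` arrives, and `e⋆` is added if that leaves a matching. -/
noncomputable def arrive (C : ℝ) (S : Finset (Fin n)) (M : Finset (Fin n × Fin m)) (l : Fin n) :
    Finset (Fin n × Fin m) :=
  match G.bestEdge C S l with
  | none => M
  | some e => addEdge M e

/-- The matching of ON-truth without the condition `c(ℓ) ≤ cost(r)`, when the left vertices arrive
in the order `π 0, π 1, …` and the first `k` of them form the offline sample. -/
noncomputable def onTruth (C : ℝ) (π : Equiv.Perm (Fin n)) (k : ℕ) : Finset (Fin n × Fin m) :=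
  ((List.ofFn π).drop k).foldl (G.arrive C ((List.ofFn π).take k).toFinset) ∅

/-- The expected utility of ON-truth without the condition `c(ℓ) ≤ cost(r)`, for a uniformly random
arrival order and an independent sample size with law `Binomial(n, 1/2)`. -/
noncomputable def expectedValue (C : ℝ) : ℝ :=
  (∑ π : Equiv.Perm (Fin n), ∑ k ∈ Finset.range (n + 1),
    (n.choose k : ℝ) * (1 / 2) ^ n * G.value (G.onTruth C π k)) / (n.factorial : ℝ)

/-- Edges at different left vertices have different buck per bang, apart from zero bids. -/
def DistinctBpb : Prop :=
  ∀ e ∈ G.edges, ∀ f ∈ G.edges, e.1 ≠ f.1 → G.c e.1 ≠ 0 → G.bpb e ≠ G.bpb f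

end

end Market

/-! One rule describes both phases. At threshold `s`, with sample `S`, go through the edges in the
fixed order: every left vertex takes its first available edge whose right vertex is not closed, and
only vertices of `S` close the right vertex they take. Edges taken inside `S` form `M₁`; the edge
taken by a vertex outside is its `e⋆`. Whether `x` lies in `S` is not felt before the edge of `x`
itself, so moving one vertex into or out of `S` gives comparable runs. The binomial sample size
makes `S` uniform among all subsets, so everything reduces to counting subsets. Summation by layers
replaces utilities by the number of edges before each position `j`.

The difficulty is that the threshold (`exit`) depends on `S`. Closing more makes it earlier. If
adding `y` to `S` moves the exit, then after the earlier exit the edge of `y` is frozen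
(`frozen_exit`), so only the single time step following that exit matters. Such a step perturbs the
run by one displacement chain (`step_invariant`, `late_cases`).

Fix `r` and `j`. If `r` is closed before `j`, it is full (some outside vertex also chose it, and
then it is matched before `j` with certainty) or bare. Taking a vertex out of a bare set leads
injectively to a full or heavy one, so closed ≤ 2 full + heavy. A heavy vertex has an outside edge
before `j` but possibly rivals after `j` (`lights`), and is matched before `j` with probability at
least `1 / (1 + lights)`. Moving a light vertex into `S` removes it and its later rivals; weighting
the lights geometrically gives `card_heavy_le`, hence a lower bound on the sum of these
probabilities. The error consists of ajar vertices that are not heavy; these are charged to full and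
loose vertices and to one step vertex per set (`sum_light_le`). The result is `sum_closed_le`: the
algorithm earns 43/126 of the mean sample greedy value, up to a multiple of the largest utility.

An optimal edge is dominated by an accepted edge at its left vertex, by a closing edge at its right
vertex, or is too expensive for the threshold; so OPT ≤ 3 heads + tails + one edge (`opt_le`). On
average tails ≤ heads + one edge, so OPT is at most 4 mean heads plus two edges, and 43/504 > 1/12.
-/

/-- A list of edges `0, 1, 2, …` of a bipartite graph, the edge `i` joining `lv i` to `rv i` and
becoming available at time `tm i`.  At a left vertex the earlier edges become available no later,
and at every positive time the edges of at most one left vertex become available. -/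
structure TimedEdges (α β : Type*) where
  lv : ℕ → α
  rv : ℕ → β
  tm : ℕ → ℕ
  tm_le : ∀ i k, i < k → lv i = lv k → tm i ≤ tm k
  lv_eq : ∀ i k, tm i = tm k → 0 < tm i → lv i = lv k

/-! ### Acceptance and its monotonicity in the closing set and in time -/

namespace TimedEdges

variable {α β : Type*} (E : TimedEdges α β)

/-- The edge `i` is accepted at time `s` for the set `S` of closing left vertices: it is available,
and no edge accepted before has the same left vertex, or the same right vertex and a closing left
vertex. -/
def Acc (S : Finset α) (s : ℕ) (i : ℕ) : Prop :=
  E.tm i ≤ s ∧ ∀ k, k < i → Acc S s k →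
    E.lv k ≠ E.lv i ∧ ¬ (E.rv k = E.rv i ∧ E.lv k ∈ S)
termination_by i

/-- The left vertex `l` has an accepted edge before the edge `j`. -/
def Tk (S : Finset α) (s : ℕ) (l : α) (j : ℕ) : Prop := ∃ i, i < j ∧ E.Acc S s i ∧ E.lv i = l

/-- The right vertex `r` is closed before the edge `j`. -/
def Cl (S : Finset α) (s : ℕ) (r : β) (j : ℕ) : Prop :=
  ∃ i, i < j ∧ E.Acc S s i ∧ E.rv i = r ∧ E.lv i ∈ S

variable {E} {S S' Q : Finset α} {s s' a a' i i' j j' k : ℕ} {r : β} {l x y : α}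

theorem acc_iff : E.Acc S s i ↔
    E.tm i ≤ s ∧ ¬ E.Tk S s (E.lv i) i ∧ ¬ E.Cl S s (E.rv i) i := by
  rw [Acc, Tk, Cl]
  refine and_congr_right fun _ => ?_
  constructor
  · intro h
    exact ⟨fun ⟨k, hk, ha, hl⟩ => (h k hk ha).1 hl,
      fun ⟨k, hk, ha, hr, hS⟩ => (h k hk ha).2 ⟨hr, hS⟩⟩
  · intro h k hk ha
    exact ⟨fun hl => h.1 ⟨k, hk, ha, hl⟩, fun hr => h.2 ⟨k, hk, ha, hr⟩⟩

theorem Acc.tm_le (h : E.Acc S s i) : E.tm i ≤ s := (acc_iff.1 h).1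

theorem Acc.not_tk (h : E.Acc S s i) : ¬ E.Tk S s (E.lv i) i := (acc_iff.1 h).2.1

theorem Acc.not_cl (h : E.Acc S s i) : ¬ E.Cl S s (E.rv i) i := (acc_iff.1 h).2.2

theorem Cl.mono (h : E.Cl S s r j) (hj : j ≤ j') : E.Cl S s r j' :=
  h.imp fun _ hi => ⟨hi.1.trans_le hj, hi.2⟩

theorem Tk.mono (h : E.Tk S s l j) (hj : j ≤ j') : E.Tk S s l j' :=
  h.imp fun _ hi => ⟨hi.1.trans_le hj, hi.2⟩

theorem Acc.eq (h : E.Acc S s i) (h' : E.Acc S s i') (hl : E.lv i = E.lv i') : i = i' := by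
  rcases lt_trichotomy i i' with hi | hi | hi
  · exact absurd ⟨i, hi, h, hl⟩ h'.not_tk
  · exact hi
  · exact absurd ⟨i', hi, h', hl.symm⟩ h.not_tk

/-- No edge at `r` is accepted after the closing edge of `r`. -/
theorem Acc.le_closing (h : E.Acc S s i) (hS : E.lv i ∈ S) (h' : E.Acc S s i')
    (hr : E.rv i' = E.rv i) : i' ≤ i :=
  le_of_not_gt fun hi => h'.not_cl ⟨i, hi, h, hr.symm, hS⟩

theorem cl_succ : E.Cl S s r (j + 1) ↔
    E.Cl S s r j ∨ (E.Acc S s j ∧ E.rv j = r ∧ E.lv j ∈ S) := by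
  constructor
  · rintro ⟨i, hi, h⟩
    rcases Nat.lt_succ_iff_lt_or_eq.1 hi with hi | rfl
    · exact Or.inl ⟨i, hi, h⟩
    · exact Or.inr h
  · rintro (h | h)
    · exact h.mono (Nat.le_succ j)
    · exact ⟨j, Nat.lt_succ_self j, h⟩

theorem tk_succ : E.Tk S s l (j + 1) ↔ E.Tk S s l j ∨ (E.Acc S s j ∧ E.lv j = l) := by
  constructor
  · rintro ⟨i, hi, h⟩
    rcases Nat.lt_succ_iff_lt_or_eq.1 hi with hi | rfl
    · exact Or.inl ⟨i, hi, h⟩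
    · exact Or.inr h
  · rintro (h | h)
    · exact h.mono (Nat.le_succ j)
    · exact ⟨j, Nat.lt_succ_self j, h⟩

/-- If more right vertices are closed, left vertices are accepted later. -/
theorem le_of_cl_imp (hcl : ∀ r j, E.Cl S s r j → E.Cl S' s' r j) (h : E.Acc S s i)
    (h' : E.Acc S' s' i') (hl : E.lv i = E.lv i') : i ≤ i' := by
  by_contra hi
  push Not at hi
  have h1 : ¬ E.Acc S s i' := fun h1 => h.not_tk ⟨i', hi, h1, hl.symm⟩
  refine h1 (acc_iff.2 ⟨(E.tm_le _ _ hi hl.symm).trans h.tm_le, fun ⟨k, hk, hk'⟩ => ?_,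
    fun hc => h'.not_cl (hcl _ _ hc)⟩)
  exact h.not_tk ⟨k, hk.trans hi, hk'.1, hk'.2.trans hl.symm⟩

/-- Only vertices leaving the closing set need checking. A vertex in both sets whose edge is not
accepted in the second state, though its right vertex is open, holds an earlier edge there. By
induction the first state has closed no more, so that edge would have been accepted there too. -/
theorem cl_imp_of (hs : s ≤ s')
    (H : ∀ i, E.Acc S s i → E.lv i ∈ S → E.lv i ∉ S' → E.Cl S' s' (E.rv i) (i + 1)) (r : β)
    (j : ℕ) (h : E.Cl S s r j) : E.Cl S' s' r j := by
  induction j using Nat.strong_induction_on generalizing r with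
  | _ j ih =>
    obtain ⟨i, hi, ha, rfl, hS⟩ := h
    by_cases hS' : E.lv i ∈ S'
    · by_cases ha' : E.Acc S' s' i
      · exact ⟨i, hi, ha', rfl, hS'⟩
      · by_contra hc
        refine ha' (acc_iff.2 ⟨ha.tm_le.trans hs, ?_, fun h => hc (h.mono hi.le)⟩)
        rintro ⟨k, hk, hak, hl⟩
        refine ha.not_tk (?_ : E.Tk S s (E.lv i) i)
        by_contra ht
        have : E.Acc S s k := acc_iff.2 ⟨(E.tm_le _ _ hk hl).trans ha.tm_le,
          fun h => ht (hl ▸ h.mono hk.le), fun h => hak.not_cl (ih k (hk.trans hi) _ h)⟩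
        exact ht ⟨k, hk, this, hl⟩
    · exact (H i ha hS hS').mono hi

theorem cl_mono (hS : S ⊆ S') (hs : s ≤ s') (r : β) (j : ℕ) (h : E.Cl S s r j) :
    E.Cl S' s' r j :=
  cl_imp_of hs (fun _ _ h1 h2 => absurd (hS h1) h2) r j h

/-- Acceptance between two states that accept the same edge. -/
theorem Acc.sandwich {S₁ S₂ S₃ : Finset α} {s₁ s₂ s₃ : ℕ}
    (h12 : ∀ r j, E.Cl S₁ s₁ r j → E.Cl S₂ s₂ r j)
    (h23 : ∀ r j, E.Cl S₂ s₂ r j → E.Cl S₃ s₃ r j) (hs : s₁ ≤ s₂)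
    (h1 : E.Acc S₁ s₁ i) (h3 : E.Acc S₃ s₃ i) : E.Acc S₂ s₂ i := by
  refine acc_iff.2 ⟨h1.tm_le.trans hs, ?_, fun h => h3.not_cl (h23 _ _ h)⟩
  rintro ⟨k, hk, hak, hl⟩
  exact absurd (le_of_cl_imp h12 h1 hak hl.symm) (not_le.2 hk)

theorem Acc.between {s₁ s₂ s₃ : ℕ} (h1 : E.Acc S s₁ i) (h3 : E.Acc S s₃ i) (h12 : s₁ ≤ s₂)
    (h23 : s₂ ≤ s₃) : E.Acc S s₂ i :=
  Acc.sandwich (cl_mono subset_rfl h12) (cl_mono subset_rfl h23) h12 h1 h3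

/-- If an edge is no longer accepted although no left vertex is accepted earlier, then its right
vertex is closed. -/
theorem Acc.cl_of_not (hcl : ∀ r j, E.Cl S s r j → E.Cl S' s' r j) (hs : s ≤ s')
    (h : E.Acc S s i) (h' : ¬ E.Acc S' s' i) : E.Cl S' s' (E.rv i) i := by
  by_contra hc
  refine h' (acc_iff.2 ⟨h.tm_le.trans hs, ?_, hc⟩)
  rintro ⟨k, hk, hak, hl⟩
  exact absurd (le_of_cl_imp hcl h hak hl.symm) (not_le.2 hk)

/-- Membership of a left vertex does not matter before it is accepted. -/
theorem acc_congr (hS : ∀ z, z ≠ x → (z ∈ S ↔ z ∈ S'))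
    (hx : ∀ i, i < j → E.Acc S s i → E.lv i ≠ x) : ∀ i, i ≤ j → (E.Acc S s i ↔ E.Acc S' s i) := by
  intro i
  induction i using Nat.strong_induction_on with
  | _ i ih =>
    intro hi
    have hT : E.Tk S s (E.lv i) i ↔ E.Tk S' s (E.lv i) i := by
      refine exists_congr fun k => and_congr_right fun hk => ?_
      rw [ih k hk (hk.le.trans hi)]
    have hC : E.Cl S s (E.rv i) i ↔ E.Cl S' s (E.rv i) i := by
      refine exists_congr fun k => and_congr_right fun hk => ?_
      rw [← ih k hk (hk.le.trans hi)]
      refine and_congr_right fun hak => ?_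
      rw [hS _ (hx k (hk.trans_le hi) hak)]
    rw [acc_iff, acc_iff, hT, hC]

theorem cl_congr (hS : ∀ z, z ≠ x → (z ∈ S ↔ z ∈ S'))
    (hx : ∀ i, i < j → E.Acc S s i → E.lv i ≠ x) (r : β) : E.Cl S s r j ↔ E.Cl S' s r j := by
  refine exists_congr fun k => and_congr_right fun hk => ?_
  rw [← acc_congr hS hx k hk.le]
  exact and_congr_right fun hak => by rw [hS _ (hx k hk hak)]

theorem Acc.ne_of_lt (h : E.Acc S s i) : ∀ k, k < i → E.Acc S s k → E.lv k ≠ E.lv i :=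
  fun k hk hak hl => h.not_tk ⟨k, hk, hak, hl⟩

section

variable [DecidableEq α]

theorem mem_insert_congr (x : α) (Q : Finset α) :
    ∀ z, z ≠ x → (z ∈ Q ↔ z ∈ insert x Q) := fun z hz => by simp [hz]

theorem Acc.insert_iff (h : E.Acc Q s i) (hk : k ≤ i) :
    E.Acc Q s k ↔ E.Acc (insert (E.lv i) Q) s k :=
  acc_congr (mem_insert_congr _ Q) h.ne_of_lt k hk

theorem Acc.insert_iff' (h : E.Acc (insert (E.lv i) Q) s i) (hk : k ≤ i) :
    E.Acc Q s k ↔ E.Acc (insert (E.lv i) Q) s k :=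
  (acc_congr (fun z hz => (mem_insert_congr _ Q z hz).symm) h.ne_of_lt k hk).symm

/-- A left vertex influences the run only after its own edge, so this edge is the same whether or
not the vertex closes. All flips of sample membership rest on this. -/
theorem acc_insert_self : E.Acc (insert (E.lv i) Q) s i ↔ E.Acc Q s i :=
  ⟨fun h => (h.insert_iff' le_rfl).2 h, fun h => (h.insert_iff le_rfl).1 h⟩

/-- Of two left vertices competing for a right vertex, the earlier one closes more. -/
theorem cl_swap (hi : E.Acc Q s i) (hk : E.Acc Q s k) (hr : E.rv i = E.rv k) (hik : i < k) :
    ∀ r j, E.Cl (insert (E.lv k) Q) s r j → E.Cl (insert (E.lv i) Q) s r j := by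
  refine cl_imp_of le_rfl fun p hp hpS hpS' => ?_
  have hpk : E.lv p = E.lv k := by
    rcases Finset.mem_insert.1 hpS with h | h
    · exact h
    · exact absurd (Finset.mem_insert_of_mem h) hpS'
  have : p = k := hp.eq (acc_insert_self.2 hk) hpk
  subst this
  exact ⟨i, hik.trans (Nat.lt_succ_self p), acc_insert_self.2 hi, hr, Finset.mem_insert_self _ _⟩

/-- If no edge of `y` is accepted both at time `a` and at time `a'`, then adding `y` at time `a`
closes no more than waiting until time `a'`. -/
theorem cl_lose (ha : a ≤ a')
    (hy : ∀ p, E.lv p = y → E.Acc Q a p → ¬ E.Acc Q a' p) :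
    ∀ r j, E.Cl (insert y Q) a r j → E.Cl Q a' r j := by
  refine cl_imp_of ha fun p hp hpS hpS' => ?_
  have hpy : E.lv p = y := (Finset.mem_insert.1 hpS).resolve_right hpS'
  subst hpy
  have hp' := acc_insert_self.1 hp
  exact (hp'.cl_of_not (cl_mono subset_rfl ha) ha (hy p rfl hp')).mono (Nat.le_succ p)

/-! ### One time step as a displacement chain -/

/-- The comparison of the states at times `a` and `a + 1`: either the same right vertices are
closed, or one more at time `a + 1`, or a left vertex still has to be accepted at time `a + 1`. -/
theorem step_invariant (Q : Finset α) (a : ℕ) {q : α} (hq : ∀ i, E.tm i = a + 1 → E.lv i = q)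
    (j : ℕ) :
    ((∀ r, E.Cl Q (a + 1) r j ↔ E.Cl Q a r j) ∧
      ∀ l ∈ Q, (E.Tk Q (a + 1) l j ↔ E.Tk Q a l j)) ∨
    (q ∈ Q ∧ E.Tk Q (a + 1) q j ∧ (∀ i, j ≤ i → E.lv i = q → a < E.tm i) ∧
      ((∃ r₀, ¬ E.Cl Q a r₀ j ∧ (∀ r, E.Cl Q (a + 1) r j ↔ E.Cl Q a r j ∨ r = r₀) ∧
        ∀ l ∈ Q, l ≠ q → (E.Tk Q (a + 1) l j ↔ E.Tk Q a l j)) ∨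
       (∃ p ∈ Q, p ≠ q ∧ (∀ r, E.Cl Q (a + 1) r j ↔ E.Cl Q a r j) ∧ E.Tk Q a p j ∧
        ¬ E.Tk Q (a + 1) p j ∧
        ∀ l ∈ Q, l ≠ q → l ≠ p → (E.Tk Q (a + 1) l j ↔ E.Tk Q a l j)))) := by
  -- The two runs differ by one token. The new edge of `q` closes an extra right vertex; when an
  -- edge of some `p` is refused there, the token becomes the unmatched `p`; when `p` finds another
  -- edge, it becomes an extra closed vertex again. All other edges of `q` after the token appears
  -- are unavailable at time `a`, so `q` does not enter twice.
  induction j with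
  | zero =>
    left
    constructor
    · intro r; simp [Cl]
    · intro l _; simp [Tk]
  | succ j ih =>
    have hN := @acc_iff α β E Q (a + 1) j
    have hO := @acc_iff α β E Q a j
    have hcN : ∀ r, _ := fun r => @cl_succ α β E Q (a + 1) j r
    have hcO : ∀ r, _ := fun r => @cl_succ α β E Q a j r
    have htN : ∀ l, _ := fun l => @tk_succ α β E Q (a + 1) j l
    have htO : ∀ l, _ := fun l => @tk_succ α β E Q a j l
    have hlast : E.tm j = a + 1 → ∀ i, j + 1 ≤ i → E.lv i = q → a < E.tm i := fun h i hi hl => by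
      have := E.tm_le j i hi ((hq j h).trans hl.symm)
      omega
    by_cases hjQ : E.lv j ∈ Q
    swap
    · have e1 : ∀ r, E.Cl Q (a + 1) r (j + 1) ↔ E.Cl Q (a + 1) r j := fun r => by
        rw [hcN]
        exact or_iff_left fun h => hjQ h.2.2
      have e2 : ∀ r, E.Cl Q a r (j + 1) ↔ E.Cl Q a r j := fun r => by
        rw [hcO]
        exact or_iff_left fun h => hjQ h.2.2
      have e3 : ∀ l ∈ Q, (E.Tk Q (a + 1) l (j + 1) ↔ E.Tk Q (a + 1) l j) := fun l hl => by
        rw [htN]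
        exact or_iff_left fun h => hjQ (h.2 ▸ hl)
      have e4 : ∀ l ∈ Q, (E.Tk Q a l (j + 1) ↔ E.Tk Q a l j) := fun l hl => by
        rw [htO]
        exact or_iff_left fun h => hjQ (h.2 ▸ hl)
      rcases ih with ⟨h1, h2⟩ | ⟨hqQ, hq1, hq2, h⟩
      · left
        exact ⟨fun r => by rw [e1, e2, h1], fun l hl => by rw [e3 l hl, e4 l hl, h2 l hl]⟩
      · right
        refine ⟨hqQ, (e3 q hqQ).2 hq1, fun i hi => hq2 i (Nat.le_of_succ_le hi), ?_⟩
        rcases h with ⟨r₀, h1, h2, h3⟩ | ⟨p, hp, hpq, h1, h2, h3, h4⟩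
        · exact Or.inl ⟨r₀, by rwa [e2], fun r => by rw [e1, e2, h2],
            fun l hl hlq => by rw [e3 l hl, e4 l hl, h3 l hl hlq]⟩
        · exact Or.inr ⟨p, hp, hpq, fun r => by rw [e1, e2, h1], by rwa [e4 p hp],
            by rwa [e3 p hp], fun l hl hlq hlp => by rw [e3 l hl, e4 l hl, h4 l hl hlq hlp]⟩
    · rcases ih with ⟨h1, h2⟩ | ⟨hqQ, hq1, hq2, h⟩
      · by_cases hA : E.Acc Q (a + 1) j ↔ E.Acc Q a j
        · left
          exact ⟨fun r => by rw [hcN, hcO, h1, hA], fun l hl => by rw [htN, htO, h2 l hl, hA]⟩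
        · have h3 : E.tm j = a + 1 := by
            by_contra h3
            apply hA
            rw [hN, hO, h1, h2 _ hjQ]
            have : E.tm j ≤ a + 1 ↔ E.tm j ≤ a := by omega
            rw [this]
          have h4 : ¬ E.Acc Q a j := fun h => by have := h.tm_le; omega
          have h5 : E.Acc Q (a + 1) j := by
            by_contra h5
            exact hA ⟨fun h => absurd h h5, fun h => absurd h h4⟩
          have h6 := hq j h3
          right
          refine ⟨h6 ▸ hjQ, (htN q).2 (Or.inr ⟨h5, h6⟩), hlast h3, Or.inl ⟨E.rv j, ?_, ?_, ?_⟩⟩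
          · rw [hcO, ← h1]
            exact fun h => h.elim h5.not_cl fun h => h4 h.1
          · intro r
            rw [hcN, hcO, h1]
            constructor
            · rintro (h | h)
              · exact Or.inl (Or.inl h)
              · exact Or.inr h.2.1.symm
            · rintro ((h | h) | h)
              · exact Or.inl h
              · exact absurd h.1 h4
              · exact Or.inr ⟨h5, h.symm, hjQ⟩
          · intro l hl hlq
            rw [htN, htO, h2 l hl]
            refine or_congr_right ⟨fun h => absurd (h.2.symm.trans h6) hlq, fun h => absurd h.1 h4⟩
      · right
        refine ⟨hqQ, hq1.mono (Nat.le_succ j), fun i hi => hq2 i (Nat.le_of_succ_le hi), ?_⟩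
        have hjq : E.lv j = q → ¬ E.Acc Q a j ∧ ¬ E.Acc Q (a + 1) j := fun h =>
          ⟨fun h' => by have := h'.tm_le; have := hq2 j le_rfl h; omega,
            fun h' => h'.not_tk (h.symm ▸ hq1)⟩
        have htm : E.tm j ≤ a + 1 → E.lv j ≠ q → E.tm j ≤ a := fun h h' => by
          have : E.tm j ≠ a + 1 := fun h'' => h' (hq j h'')
          omega
        rcases h with ⟨r₀, h1, h2, h3⟩ | ⟨p, hp, hpq, h1, h2, h3, h4⟩
        · by_cases hA : E.Acc Q (a + 1) j ↔ E.Acc Q a j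
          · left
            refine ⟨r₀, ?_, fun r => by rw [hcN, hcO, h2, hA, or_right_comm],
              fun l hl hlq => by rw [htN, htO, h3 l hl hlq, hA]⟩
            rw [hcO]
            rintro (h | ⟨h, rfl, h'⟩)
            · exact h1 h
            · exact (hA.2 h).not_cl ((h2 _).2 (Or.inr rfl))
          · have hjne : E.lv j ≠ q := fun h => hA (by simp [hjq h])
            have h5 : E.Acc Q a j ∧ ¬ E.Acc Q (a + 1) j ∧ E.rv j = r₀ := by
              have e : E.tm j ≤ a + 1 ↔ E.tm j ≤ a := ⟨fun h => htm h hjne, fun h => by omega⟩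
              rw [hN, hO, h2, h3 _ hjQ hjne, e] at hA
              rw [hN, hO, h2, h3 _ hjQ hjne, e]
              clear * - hA
              tauto
            obtain ⟨h5, h6, rfl⟩ := h5
            right
            refine ⟨E.lv j, hjQ, hjne, fun r => ?_, (htO _).2 (Or.inr ⟨h5, rfl⟩), ?_, ?_⟩
            · rw [hcN, hcO, h2]
              constructor
              · rintro ((h | h) | h)
                · exact Or.inl h
                · exact Or.inr ⟨h5, h.symm, hjQ⟩
                · exact absurd h.1 h6
              · rintro (h | h)
                · exact Or.inl (Or.inl h)
                · exact Or.inl (Or.inr h.2.1.symm)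
            · rw [htN, h3 _ hjQ hjne]
              exact fun h => h.elim h5.not_tk fun h => h6 h.1
            · intro l hl hlq hlp
              rw [htN, htO, h3 l hl hlq]
              exact or_congr_right ⟨fun h => absurd h.2.symm hlp, fun h => absurd h.2.symm hlp⟩
        · by_cases hA : E.Acc Q (a + 1) j ↔ E.Acc Q a j
          · right
            refine ⟨p, hp, hpq, fun r => by rw [hcN, hcO, h1, hA], h2.mono (Nat.le_succ j), ?_,
              fun l hl hlq hlp => by rw [htN, htO, h4 l hl hlq hlp, hA]⟩
            rw [htN]
            exact fun h => h.elim h3 fun h => (hA.1 h.1).not_tk (h.2.symm ▸ h2)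
          · have hjne : E.lv j ≠ q := fun h => hA (by simp [hjq h])
            have hjp : E.lv j = p := by
              by_contra hjp
              apply hA
              have e : E.tm j ≤ a + 1 ↔ E.tm j ≤ a := ⟨fun h => htm h hjne, fun h => by omega⟩
              rw [hN, hO, h1, h4 _ hjQ hjne hjp, e]
            subst hjp
            have h5 : ¬ E.Acc Q a j := fun h => h.not_tk h2
            have h6 : E.Acc Q (a + 1) j := by
              by_contra h6
              exact hA ⟨fun h => absurd h h6, fun h => absurd h h5⟩
            left
            refine ⟨E.rv j, ?_, fun r => ?_, fun l hl hlq => ?_⟩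
            · rw [hcO, ← h1]
              exact fun h => h.elim h6.not_cl fun h => h5 h.1
            · rw [hcN, hcO, h1]
              constructor
              · rintro (h | h)
                · exact Or.inl (Or.inl h)
                · exact Or.inr h.2.1.symm
              · rintro ((h | h) | h)
                · exact Or.inl h
                · exact absurd h.1 h5
                · exact Or.inr ⟨h6, h.symm, hjQ⟩
            · rw [htN, htO]
              by_cases hlp : l = E.lv j
              · subst hlp
                simp [h2, h6]
              · rw [h4 l hl hlq hlp]
                exact or_congr_right ⟨fun h => absurd h.2.symm hlp, fun h => absurd h.2.symm hlp⟩

end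

end TimedEdges

namespace TimedEdges

variable {α β : Type*} (E : TimedEdges α β)

open scoped Classical in
/-- The left vertex whose edges become available at the time `s`. -/
noncomputable def stepVertex (s : ℕ) : α :=
  -- `E.lv 0` is a filler for times at which no edge becomes available.
  if h : ∃ i, E.tm i = s then E.lv h.choose else E.lv 0

variable {E} {S S' Q : Finset α} {s s' a a' i i' j j' k : ℕ} {r : β} {l x y : α}

theorem lv_eq_stepVertex (hs : 0 < s) (h : E.tm i = s) : E.lv i = E.stepVertex s := by
  have h' : ∃ i, E.tm i = s := ⟨i, h⟩
  rw [stepVertex, dif_pos h']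
  exact E.lv_eq _ _ (h.trans h'.choose_spec.symm) (h ▸ hs)

open scoped Classical in
/-- The closing edges before `j`. -/
noncomputable def closings (E : TimedEdges α β) (S : Finset α) (s j : ℕ) : Finset ℕ :=
  (Finset.range j).filter fun i => E.Acc S s i ∧ E.lv i ∈ S

open scoped Classical in
theorem mem_closings : i ∈ E.closings S s j ↔ i < j ∧ E.Acc S s i ∧ E.lv i ∈ S := by
  rw [closings, Finset.mem_filter, Finset.mem_range]

open scoped Classical in
/-- Closing edges and closed right vertices correspond. -/
theorem card_closings [Fintype β] (S : Finset α) (s j : ℕ) :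
    (E.closings S s j).card = (Finset.univ.filter fun r => E.Cl S s r j).card := by
  refine Finset.card_bij (fun i _ => E.rv i) ?_ ?_ ?_
  · intro i hi
    rw [mem_closings] at hi
    exact Finset.mem_filter.2 ⟨Finset.mem_univ _, i, hi.1, hi.2.1, rfl, hi.2.2⟩
  · intro i hi i' hi' h
    rw [mem_closings] at hi hi'
    exact le_antisymm (hi'.2.1.le_closing hi'.2.2 hi.2.1 h)
      (hi.2.1.le_closing hi.2.2 hi'.2.1 h.symm)
  · intro r hr
    obtain ⟨i, hij, hi, hir, hiS⟩ := (Finset.mem_filter.1 hr).2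
    exact ⟨i, mem_closings.2 ⟨hij, hi, hiS⟩, hir⟩

variable [DecidableEq α]

theorem cl_step_of_not_mem (hq : E.stepVertex (a + 1) ∉ Q) (r : β) (j : ℕ) :
    E.Cl Q (a + 1) r j ↔ E.Cl Q a r j := by
  rcases step_invariant Q a (fun i => lv_eq_stepVertex (Nat.succ_pos a)) j with h | h
  · exact h.1 r
  · exact absurd h.1 hq

/-- In one time step at most one more right vertex is closed. -/
theorem cl_step (Q : Finset α) (a j : ℕ) :
    ∃ r₀, ∀ r, E.Cl Q (a + 1) r j → E.Cl Q a r j ∨ r = r₀ := by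
  rcases step_invariant (E := E) Q a (fun i => lv_eq_stepVertex (Nat.succ_pos a)) j with
    h | ⟨-, -, -, ⟨r₀, -, h, -⟩ | ⟨p, -, -, h, -⟩⟩
  · exact ⟨E.rv 0, fun r hr => Or.inl ((h.1 r).1 hr)⟩
  · exact ⟨r₀, fun r hr => (h r).1 hr⟩
  · exact ⟨E.rv 0, fun r hr => Or.inl ((h r).1 hr)⟩

/-- After the edge `p`, which is accepted at time `a` but no longer at time `a + 1`, the state at
time `a + 1` closes the same right vertices as the state at time `a` with `lv p` closing. -/
theorem cl_iff_of_lost {p : ℕ} (hpQ : E.lv p ∉ Q) (hp : E.Acc Q a p) (hp' : ¬ E.Acc Q (a + 1) p) :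
    E.stepVertex (a + 1) ∈ Q ∧
      ∀ j, p < j → ∀ r, E.Cl Q (a + 1) r j ↔ E.Cl (insert (E.lv p) Q) a r j := by
  have hcl := hp.cl_of_not (cl_mono subset_rfl (Nat.le_succ a)) (Nat.le_succ a) hp'
  have htm := fun i => lv_eq_stepVertex (E := E) (i := i) (Nat.succ_pos a)
  have hW : E.Acc (insert (E.lv p) Q) a p := acc_insert_self.2 hp
  have hCW : ∀ r, E.Cl Q a r p ↔ E.Cl (insert (E.lv p) Q) a r p :=
    cl_congr (mem_insert_congr _ Q) hp.ne_of_lt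
  have hTW : ∀ l, E.Tk Q a l p ↔ E.Tk (insert (E.lv p) Q) a l p := fun l =>
    exists_congr fun k => and_congr_right fun hk => by rw [hp.insert_iff hk.le]
  obtain ⟨hqQ, hq1, hq2, r₀, h1, h2, h3⟩ : E.stepVertex (a + 1) ∈ Q ∧
      E.Tk Q (a + 1) (E.stepVertex (a + 1)) p ∧
      (∀ i, p ≤ i → E.lv i = E.stepVertex (a + 1) → a < E.tm i) ∧
      ∃ r₀, ¬ E.Cl Q a r₀ p ∧ (∀ r, E.Cl Q (a + 1) r p ↔ E.Cl Q a r p ∨ r = r₀) ∧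
        ∀ l ∈ Q, l ≠ E.stepVertex (a + 1) → (E.Tk Q (a + 1) l p ↔ E.Tk Q a l p) := by
    -- The vertex `rv p` is closed before `p` at time `a + 1` but not at time `a`, which leaves only
    -- the case of one extra closed vertex, and that vertex is `rv p`.
    rcases step_invariant Q a htm p with h | ⟨h1, h2, h3, h | ⟨_, -, -, h, -⟩⟩
    · exact absurd ((h.1 _).1 hcl) hp.not_cl
    · exact ⟨h1, h2, h3, h⟩
    · exact absurd ((h _).1 hcl) hp.not_cl
  have hr₀ : E.rv p = r₀ := ((h2 _).1 hcl).resolve_left hp.not_cl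
  subst hr₀
  refine ⟨hqQ, ?_⟩
  -- With `lv p` closing at time `a`, the edge `p` fills exactly the extra closed vertex. From there
  -- the runs agree on `Q` except for the step vertex, which is already matched at `a + 1` and has
  -- no remaining edge at time `a`.
  suffices H : ∀ j, p < j → (∀ r, E.Cl Q (a + 1) r j ↔ E.Cl (insert (E.lv p) Q) a r j) ∧
      ∀ l ∈ Q, l ≠ E.stepVertex (a + 1) →
        (E.Tk Q (a + 1) l j ↔ E.Tk (insert (E.lv p) Q) a l j) from fun j hj => (H j hj).1
  intro j hj
  induction j, hj using Nat.le_induction with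
  | base =>
    constructor
    · intro r
      rw [cl_succ, cl_succ, h2, ← hCW]
      constructor
      · rintro ((h | rfl) | h)
        · exact Or.inl h
        · exact Or.inr ⟨hW, rfl, Finset.mem_insert_self _ _⟩
        · exact absurd h.1 hp'
      · rintro (h | h)
        · exact Or.inl (Or.inl h)
        · exact Or.inl (Or.inr h.2.1.symm)
    · intro l hl hlq
      rw [tk_succ, tk_succ, h3 l hl hlq, hTW]
      exact or_congr_right ⟨fun h => absurd h.1 hp', fun h => absurd (h.2 ▸ hl) hpQ⟩
  | succ j hj ih =>
    obtain ⟨ih1, ih2⟩ := ih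
    have hj' : p ≤ j := Nat.le_of_succ_le hj
    have key : E.lv j ∈ Q → (E.Acc Q (a + 1) j ↔ E.Acc (insert (E.lv p) Q) a j) := by
      intro hjQ
      by_cases hjq : E.lv j = E.stepVertex (a + 1)
      · constructor
        · exact fun h => absurd (hjq ▸ hq1.mono hj') h.not_tk
        · intro h
          have := h.tm_le
          have := hq2 j hj' hjq
          omega
      · have e : E.tm j ≤ a + 1 ↔ E.tm j ≤ a := by
          have : E.tm j ≠ a + 1 := fun h => hjq (htm j h)
          omega
        rw [acc_iff, acc_iff, ih1, ih2 _ hjQ hjq, e]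
    have hjW : E.lv j = E.lv p → ¬ E.Acc (insert (E.lv p) Q) a j := fun h hA =>
      hA.not_tk ⟨p, hj, hW, h.symm⟩
    constructor
    · intro r
      rw [cl_succ, cl_succ, ih1]
      refine or_congr_right ⟨fun h => ⟨(key h.2.2).1 h.1, h.2.1, Finset.mem_insert_of_mem h.2.2⟩,
        fun h => ?_⟩
      have hjQ : E.lv j ∈ Q :=
        (Finset.mem_insert.1 h.2.2).resolve_left fun h' => hjW h' h.1
      exact ⟨(key hjQ).2 h.1, h.2.1, hjQ⟩
    · intro l hl hlq
      rw [tk_succ, tk_succ, ih2 l hl hlq]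
      exact or_congr_right ⟨fun h => ⟨(key (h.2 ▸ hl)).1 h.1, h.2⟩,
        fun h => ⟨(key (h.2 ▸ hl)).2 h.1, h.2⟩⟩

/-- A left vertex that gets the edge `i` in the step to time `a + 1` had an edge before, or is the
step vertex. -/
theorem late_cases (hQ : E.lv i ∉ Q) (h : E.Acc Q (a + 1) i) (h' : ¬ E.Acc Q a i) :
    (∃ p, p < i ∧ E.lv p = E.lv i ∧ E.Acc Q a p ∧ ¬ E.Acc Q (a + 1) p ∧
      E.stepVertex (a + 1) ∈ Q ∧
      ∀ j, p < j → ∀ r, E.Cl Q (a + 1) r j ↔ E.Cl (insert (E.lv i) Q) a r j) ∨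
    (E.lv i = E.stepVertex (a + 1) ∧ E.tm i = a + 1 ∧ ¬ E.Tk Q a (E.lv i) i ∧
      ∀ j r, E.Cl Q (a + 1) r j ↔ E.Cl (insert (E.lv i) Q) a r j) := by
  have hcl : ¬ E.Cl Q a (E.rv i) i := fun h1 =>
    h.not_cl (cl_mono subset_rfl (Nat.le_succ a) _ _ h1)
  by_cases ht : E.Tk Q a (E.lv i) i
  · obtain ⟨p, hpi, hp, hl⟩ := ht
    have hp' : ¬ E.Acc Q (a + 1) p := fun h1 => h.not_tk ⟨p, hpi, h1, hl⟩
    obtain ⟨h1, h2⟩ := cl_iff_of_lost (hl ▸ hQ) hp hp'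
    exact Or.inl ⟨p, hpi, hl, hp, hp', h1, hl ▸ h2⟩
  · have htm : E.tm i = a + 1 := by
      have h1 : ¬ E.tm i ≤ a := fun h1 => h' (acc_iff.2 ⟨h1, ht, hcl⟩)
      have := h.tm_le
      omega
    have hq := lv_eq_stepVertex (Nat.succ_pos a) htm
    refine Or.inr ⟨hq, htm, ht, fun j r => ?_⟩
    rw [cl_step_of_not_mem (hq ▸ hQ)]
    refine cl_congr (mem_insert_congr _ Q) (fun k _ hk hl => ?_) r
    rcases lt_trichotomy k i with hki | rfl | hki
    · exact ht ⟨k, hki, hk, hl⟩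
    · exact h' hk
    · have := E.tm_le i k hki hl.symm
      have := hk.tm_le
      omega

end TimedEdges

/-! ### Exit times and frozen edges -/

/-- Timed edges together with a stopping rule: a state is dead or alive, it stays dead when time
goes on and when more right vertices are closed. -/
structure StoppedEdges (α β : Type*) extends TimedEdges α β where
  dead : Finset α → ℕ → Prop
  horizon : ℕ
  size : ℕ
  lt_tm : ∀ i, size ≤ i → horizon < tm i
  alive_zero : ∀ S, ¬ dead S 0
  dead_mono : ∀ S S' s s', s ≤ s' →
    (∀ r j, toTimedEdges.Cl S s r j → toTimedEdges.Cl S' s' r j) → dead S s → dead S' s'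

namespace StoppedEdges

open TimedEdges

variable {α β : Type*} (E : StoppedEdges α β)

open scoped Classical in
/-- The last time at which the closing set `S` is alive. -/
noncomputable def exit (S : Finset α) : ℕ := Nat.findGreatest (fun s => ¬ E.dead S s) E.horizon

/-- The edge `i` is accepted in the state in which `S` exits. -/
def Out (S : Finset α) (i : ℕ) : Prop := E.Acc S (E.exit S) i

/-- The right vertex `r` is closed before the edge `j` when `S` exits. -/
def Closed (r : β) (j : ℕ) (S : Finset α) : Prop := E.Cl S (E.exit S) r j

variable {E} {S S' Q Z : Finset α} {s s' a a' i i' j j' k : ℕ} {r : β} {l x y : α}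

theorem exit_le : E.exit S ≤ E.horizon := by
  classical
  exact Nat.findGreatest_le _

theorem alive_exit : ¬ E.dead S (E.exit S) := by
  classical
  exact Nat.findGreatest_spec (P := fun s => ¬ E.dead S s) (Nat.zero_le _) (E.alive_zero S)

theorem dead_of_le (hs : s ≤ s') (h : E.dead S s) : E.dead S s' :=
  E.dead_mono _ _ _ _ hs (cl_mono subset_rfl hs) h

theorem alive_of_le (h : s ≤ E.exit S) : ¬ E.dead S s := fun hd => alive_exit (dead_of_le h hd)

theorem le_exit (h : s ≤ E.horizon) (ha : ¬ E.dead S s) : s ≤ E.exit S := by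
  classical
  exact Nat.le_findGreatest h ha

theorem dead_of_lt (h : E.exit S < s) (hs : s ≤ E.horizon) : E.dead S s := by
  by_contra ha
  exact absurd (le_exit hs ha) (not_le.2 h)

theorem exit_anti (h : S ⊆ S') : E.exit S' ≤ E.exit S :=
  le_exit exit_le fun hd => alive_exit (E.dead_mono _ _ _ _ le_rfl (cl_mono h le_rfl) hd)

variable [DecidableEq α]

theorem exit_insert_le : E.exit (insert x S) ≤ E.exit S := exit_anti (Finset.subset_insert _ _)

/-- If `S` is alive at time `a'` but dead already at time `a` with `y` closing, then `y` keeps the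
same edge from `a` to `a'`. -/
theorem frozen (ha : a ≤ a') (h : ¬ E.dead S a') (hd : E.dead (insert y S) a) :
    ∃ p, E.lv p = y ∧ E.Acc S a p ∧ E.Acc S a' p := by
  by_contra hp
  push Not at hp
  exact h (E.dead_mono _ _ _ _ ha (cl_lose ha hp) hd)

/-- If `S` outlives `insert y S` by the time `a`, the edge of `y` is the same from then on. -/
theorem frozen_exit (hd : E.exit (insert y S) < a) (ha : a ≤ E.exit S) :
    ∃ p, E.lv p = y ∧ E.Acc S a p ∧ E.Out S p :=
  frozen ha alive_exit (dead_of_lt hd (ha.trans exit_le))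

theorem frozen_exit' (hd : E.exit (insert (E.lv i) S) < a) (ha : a ≤ E.exit S)
    (h : E.Acc S a i ∨ E.Out S i) : E.Acc S a i ∧ E.Out S i := by
  obtain ⟨p, hl, h1, h2⟩ := frozen_exit hd ha
  rcases h with h | h
  · obtain rfl := h1.eq h hl
    exact ⟨h1, h2⟩
  · obtain rfl := h2.eq h hl
    exact ⟨h1, h2⟩

end StoppedEdges

/-! ### Charging bare vertices to full and heavy ones -/

namespace StoppedEdges

open TimedEdges

variable {α β : Type*} (E : StoppedEdges α β)

/-- `r` is closed before `j`, and has also received an edge of a left vertex outside of `S`. -/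
def Full (r : β) (j : ℕ) (S : Finset α) : Prop :=
  E.Closed r j S ∧ ∃ i, E.Out S i ∧ E.rv i = r ∧ E.lv i ∉ S

/-- `r` is closed before `j`, and has received no edge of a left vertex outside of `S`. -/
def Bare (r : β) (j : ℕ) (S : Finset α) : Prop :=
  E.Closed r j S ∧ ∀ i, E.Out S i → E.rv i = r → E.lv i ∈ S

/-- `r` is not closed before `j`, and has received an earlier edge of a left vertex outside. -/
def Ajar (r : β) (j : ℕ) (S : Finset α) : Prop :=
  ¬ E.Closed r j S ∧ ∃ i, i < j ∧ E.Out S i ∧ E.rv i = r ∧ E.lv i ∉ S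

section

variable [DecidableEq α]

/-- The left vertex of the edge `i` is not in `S` and has this edge at the exit of `S` and at the
exit of `insert (lv i) S`. -/
def Firm (S : Finset α) (i : ℕ) : Prop :=
  E.lv i ∉ S ∧ E.Out S i ∧ E.Acc S (E.exit (insert (E.lv i) S)) i

/-- `r` is not closed before `j`, and has received an earlier firm edge. -/
def Heavy (r : β) (j : ℕ) (S : Finset α) : Prop :=
  ¬ E.Closed r j S ∧ ∃ i, i < j ∧ E.rv i = r ∧ E.Firm S i

/-- The closing left vertex of the bare vertex `r` is firm after its removal. -/
def FirmRel (r : β) (j : ℕ) (S Z : Finset α) : Prop :=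
  ∃ i, i < j ∧ E.rv i = r ∧ S = insert (E.lv i) Z ∧ E.Firm Z i

/-- The closing left vertex of the bare vertex `r` would lose its edge; the left vertex which
takes its place is removed. -/
def LostRel (r : β) (j : ℕ) (S Z : Finset α) : Prop :=
  ∃ i k, i < j ∧ k < i ∧ E.rv i = r ∧ E.rv k = r ∧ E.lv k ∉ Z ∧ E.lv i ∈ Z ∧
    S = insert (E.lv k) Z ∧ E.Out S i ∧ E.exit S + 1 ≤ E.exit Z ∧
    E.Acc Z (E.exit S + 1) k ∧ E.Acc Z (E.exit S + 1) i ∧ E.Out Z k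

end

variable {E} {S S' S₁ S₂ Q Z : Finset α} {s s' a a' i i' j j' k : ℕ} {r : β} {l x y : α}

/-- Nothing is accepted at a bare vertex before its closing edge, not even earlier in time or for
a smaller set. -/
theorem Bare.le (h : E.Bare r j S) (hi : E.Out S i) (hr : E.rv i = r) (hS : S' ⊆ S)
    (ha : a ≤ E.exit S) (hk : E.Acc S' a k) (hkr : E.rv k = r) : i ≤ k := by
  by_contra hki
  push Not at hki
  have hcl := cl_mono (E := E.toTimedEdges) hS ha
  by_cases hk' : E.Out S k
  · exact hi.not_cl ⟨k, hki, hk', hkr.trans hr.symm, h.2 k hk' hkr⟩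
  · exact hi.not_cl ((hr.trans hkr.symm) ▸ (hk.cl_of_not hcl ha hk').mono hki.le)

variable [DecidableEq α]

theorem Heavy.ajar (h : E.Heavy r j S) : E.Ajar r j S := by
  obtain ⟨h, i, hi, hr, hf⟩ := h
  exact ⟨h, i, hi, hf.2.1, hr, hf.1⟩

/-- If the closing vertex `x` of `r` loses its edge when removed, an earlier edge `k` of some `y` in
the sample takes `r`. Removing `y` instead of `x` leaves `x` closing `r` while `y` chooses `r` from
outside: as `k` precedes `i`, `x` closes no more than `y` does (`cl_swap`), so the exit is late
enough, and then the edge of `y` is frozen. -/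
theorem exists_lostRel (hij : i < j) (hi : E.Out S i) (hr : E.rv i = r)
    (hiS : E.lv i ∈ S) (hZ : ¬ E.Out (S.erase (E.lv i)) i) :
    ∃ Z, E.LostRel r j S Z ∧ E.Full r j Z := by
  set x := E.lv i with hx
  set Z := S.erase x with hZdef
  have hins : insert x Z = S := Finset.insert_erase hiS
  have hxZ : x ∉ Z := Finset.notMem_erase _ _
  have hab : E.exit S ≤ E.exit Z := exit_anti (Finset.erase_subset _ _)
  have hZi : E.Acc Z (E.exit S) i := acc_insert_self.1 (by rw [← hx, hins]; exact hi)
  have hlt : E.exit S < E.exit Z := by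
    refine lt_of_le_of_ne hab fun he => hZ ?_
    rw [Out, ← he]
    exact hZi
  -- After the exit of `S` the edge of `x` is frozen up to the exit of `Z`, so it must be lost in
  -- the first step.
  have hZi' : ¬ E.Acc Z (E.exit S + 1) i := fun h1 =>
    hZ (frozen_exit' (by rw [← hx, hins]; exact Nat.lt_succ_self _) hlt (Or.inl h1)).2
  have hstep := cl_mono (E := E.toTimedEdges) (subset_refl Z) (Nat.le_succ (E.exit S))
  obtain ⟨k, hki, hk, hkr, hkZ⟩ := hZi.cl_of_not hstep (Nat.le_succ _) hZi'
  set y := E.lv k with hy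
  set Q := Z.erase y with hQdef
  have hinsQ : insert y Q = Z := Finset.insert_erase hkZ
  have hyQ : y ∉ Q := Finset.notMem_erase _ _
  have hkQ : E.Acc Q (E.exit S + 1) k := acc_insert_self.1 (by rw [← hy, hinsQ]; exact hk)
  have hkQ' : ¬ E.Acc Q (E.exit S) k := fun h1 => hZi.not_cl
    ⟨k, hki, by rw [← hinsQ]; exact acc_insert_self.2 h1, hkr, hkZ⟩
  have hcl1 : ∀ r j, E.Cl Z (E.exit S) r j → E.Cl Q (E.exit S + 1) r j := by
    rw [← hinsQ]
    refine cl_lose (Nat.le_succ _) fun p hp hp1 hp2 => hkQ' ?_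
    obtain rfl := hp2.eq hkQ hp
    exact hp1
  -- By `late_cases`, the step to `exit S + 1` without `y` closes before `i` the same vertices as
  -- `y` closing at `exit S`; there `r` was still open for `i`.
  have hcl2 : ¬ E.Cl Q (E.exit S + 1) (E.rv i) i := by
    have : E.Cl Q (E.exit S + 1) (E.rv i) i ↔ E.Cl Z (E.exit S) (E.rv i) i := by
      rw [← hinsQ]
      rcases late_cases hyQ hkQ hkQ' with ⟨p, hp, -, -, -, -, h1⟩ | ⟨-, -, -, h1⟩
      · exact h1 i (hp.trans hki) _
      · exact h1 i _
    rw [this]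
    exact hZi.not_cl
  have hxy : x ≠ y := fun h => hxZ (h ▸ hkZ)
  have hiQ : E.Acc Q (E.exit S + 1) i := by
    refine acc_iff.2 ⟨hZi.tm_le.trans (Nat.le_succ _), ?_, hcl2⟩
    rintro ⟨p, hp, hp1, hp2⟩
    exact absurd (le_of_cl_imp hcl1 hZi hp1 hp2.symm) (not_le.2 hp)
  set Z' := insert x Q with hZ'
  have hS : S = insert y Z' := by rw [hZ', Finset.insert_comm, hinsQ, hins]
  have hyZ' : y ∉ Z' := by
    rw [hZ', Finset.mem_insert]
    rintro (h1 | h1)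
    · exact hxy h1.symm
    · exact hyQ h1
  have hxZ' : x ∈ Z' := Finset.mem_insert_self _ _
  have hsw : ∀ r j, E.Cl Z' (E.exit S + 1) r j → E.Cl Z (E.exit S + 1) r j := by
    rw [← hinsQ]
    exact cl_swap hkQ hiQ hkr hki
  have hZ'a : E.exit S + 1 ≤ E.exit Z' := le_exit ((Nat.succ_le_of_lt hlt).trans exit_le) fun hd =>
    alive_of_le hlt (E.dead_mono _ _ _ _ le_rfl hsw hd)
  have hiZ' : E.Acc Z' (E.exit S + 1) i := acc_insert_self.2 hiQ
  have hkZ' : E.Acc Z' (E.exit S + 1) k := (hiQ.insert_iff hki.le).1 hkQ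
  have hout : E.Out Z' k := (frozen_exit' (by rw [← hy, ← hS]; exact Nat.lt_succ_self _) hZ'a
    (Or.inl hkZ')).2
  refine ⟨Z', ⟨i, k, hij, hki, hr, hkr.trans hr, hyZ', hxZ', hS, hi, hZ'a, hkZ', hiZ', hout⟩, ?_, ?_⟩
  · exact cl_mono subset_rfl hZ'a _ _ ⟨i, hij, hiZ', hr, hxZ'⟩
  · exact ⟨k, hout, hkr.trans hr, hyZ'⟩

theorem Bare.exists_rel (h : E.Bare r j S) :
    ∃ Z, (E.FirmRel r j S Z ∧ (E.Full r j Z ∨ E.Heavy r j Z)) ∨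
      (E.LostRel r j S Z ∧ E.Full r j Z) := by
  obtain ⟨i, hij, hi, hr, hiS⟩ := h.1
  by_cases hZ : E.Out (S.erase (E.lv i)) i
  · have hins : insert (E.lv i) (S.erase (E.lv i)) = S := Finset.insert_erase hiS
    have hxZ : E.lv i ∉ S.erase (E.lv i) := Finset.notMem_erase _ _
    have hf : E.Firm (S.erase (E.lv i)) i :=
      ⟨hxZ, hZ, by rw [hins]; exact acc_insert_self.1 (by rw [hins]; exact hi)⟩
    refine ⟨S.erase (E.lv i), Or.inl ⟨⟨i, hij, hr, hins.symm, hf⟩, ?_⟩⟩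
    by_cases hc : E.Closed r j (S.erase (E.lv i))
    · exact Or.inl ⟨hc, i, hZ, hr, hxZ⟩
    · exact Or.inr ⟨hc, i, hij, hr, hf⟩
  · obtain ⟨Z, hZ⟩ := exists_lostRel hij hi hr hiS hZ
    exact ⟨Z, Or.inr hZ⟩

/-- At a bare vertex nothing is accepted before the closing edge, so the set with the later exit has
the earlier closing edge. If the edges differed, `cl_swap` would force the exits to coincide, and
bareness of the other set would give the reverse inequality. -/
theorem FirmRel.eq (h₁ : E.Bare r j S₁) (h₂ : E.Bare r j S₂) (h1 : E.FirmRel r j S₁ Z)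
    (h2 : E.FirmRel r j S₂ Z) : S₁ = S₂ := by
  wlog hle : E.exit S₁ ≤ E.exit S₂ generalizing S₁ S₂
  · exact (this h₂ h₁ h2 h1 (le_of_not_ge hle)).symm
  obtain ⟨i₁, -, hr₁, rfl, hf₁⟩ := h1
  obtain ⟨i₂, -, hr₂, rfl, hf₂⟩ := h2
  have hi₁ : E.Acc Z (E.exit (insert (E.lv i₂) Z)) i₁ :=
    hf₁.2.2.between hf₁.2.1 hle exit_insert_le
  have h21 : i₂ ≤ i₁ := h₂.le (acc_insert_self.2 hf₂.2.2) hr₂ (Finset.subset_insert _ _) le_rfl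
    hi₁ hr₁
  rcases h21.eq_or_lt with rfl | h21
  · rfl
  have hsw := cl_swap hf₂.2.2 hi₁ (hr₂.trans hr₁.symm) h21
  have hle' : E.exit (insert (E.lv i₂) Z) ≤ E.exit (insert (E.lv i₁) Z) :=
    le_exit exit_le fun hd => alive_exit (E.dead_mono _ _ _ _ le_rfl hsw hd)
  have := h₁.le (acc_insert_self.2 hf₁.2.2) hr₁ (Finset.subset_insert _ _) hle'.ge
    (le_antisymm hle hle' ▸ hf₂.2.2) hr₂
  omega

theorem FirmRel.eq_of_lostRel (h₁ : E.Bare r j S₁) (h₂ : E.Bare r j S₂)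
    (h1 : E.FirmRel r j S₁ Z) (h2 : E.LostRel r j S₂ Z) : S₁ = S₂ := by
  obtain ⟨i₁, -, hr₁, rfl, hf₁⟩ := h1
  obtain ⟨i₂, k, -, hki, hr₂, hrk, hkZ, hiZ, rfl, hout, hle, hk, hi, hZk⟩ := h2
  rcases Nat.lt_or_ge (E.exit (insert (E.lv k) Z)) (E.exit (insert (E.lv i₁) Z)) with hlt | hge
  · have hk1 : E.Acc Z (E.exit (insert (E.lv i₁) Z)) k := hk.between hZk hlt exit_insert_le
    have hik : i₁ ≤ k := h₁.le (acc_insert_self.2 hf₁.2.2) hr₁ (Finset.subset_insert _ _) le_rfl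
      hk1 hrk
    rcases hik.eq_or_lt with rfl | hik
    · rfl
    have hsw := cl_swap hf₁.2.2 hk1 (hr₁.trans hrk.symm) hik
    exact absurd (le_exit exit_le fun hd => alive_exit (E.dead_mono _ _ _ _ le_rfl hsw hd))
      (not_le.2 hlt)
  · have h1 : E.Acc Z (E.exit (insert (E.lv k) Z)) i₁ := hf₁.2.2.between hf₁.2.1 hge
      exit_insert_le
    have h2 : E.Acc Z (E.exit (insert (E.lv k) Z) + 1) i₁ :=
      hf₁.2.2.between hf₁.2.1 (hge.trans (Nat.le_succ _)) hle
    have h3 : i₂ ≤ i₁ := h₂.le hout hr₂ (Finset.subset_insert _ _) le_rfl h1 hr₁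
    have h4 : i₁ ≤ i₂ := hi.le_closing hiZ h2 (hr₁.trans hr₂.symm)
    exact absurd hiZ (le_antisymm h4 h3 ▸ hf₁.1)

/-- With different exits, the frozen edge of the replaced vertex is already present at the later
exit, where bareness and the closing edge pin it to an edge of `Z`. With equal exits, both replacing
edges arrive in the same step and their displacement chains conflict. -/
theorem LostRel.eq (h₁ : E.Bare r j S₁) (h₂ : E.Bare r j S₂) (h1 : E.LostRel r j S₁ Z)
    (h2 : E.LostRel r j S₂ Z) : S₁ = S₂ := by
  wlog hle : E.exit S₁ ≤ E.exit S₂ generalizing S₁ S₂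
  · exact (this h₂ h₁ h2 h1 (le_of_not_ge hle)).symm
  obtain ⟨i₁, k₁, -, hki₁, hr₁, hrk₁, hkZ₁, hiZ₁, rfl, hout₁, hle₁, hk₁, hi₁, hZk₁⟩ := h1
  obtain ⟨i₂, k₂, -, hki₂, hr₂, hrk₂, hkZ₂, hiZ₂, rfl, hout₂, hle₂, hk₂, hi₂, hZk₂⟩ := h2
  rcases hle.lt_or_eq with hlt | heq
  · have h1 := hk₁.between hZk₁ hlt exit_insert_le
    have h2 := hk₁.between hZk₁ (Nat.succ_le_succ hlt.le) hle₂
    have h3 : i₂ ≤ k₁ := h₂.le hout₂ hr₂ (Finset.subset_insert _ _) le_rfl h1 hrk₁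
    have h4 : k₁ ≤ i₂ := hi₂.le_closing hiZ₂ h2 (hrk₁.trans hr₂.symm)
    exact absurd hiZ₂ (le_antisymm h4 h3 ▸ hkZ₁)
  · rw [← heq] at hk₂ hi₂
    set a := E.exit (insert (E.lv k₁) Z) with ha
    have hi : i₁ = i₂ := le_antisymm (hi₂.le_closing hiZ₂ hi₁ (hr₁.trans hr₂.symm))
      (hi₁.le_closing hiZ₁ hi₂ (hr₂.trans hr₁.symm))
    subst hi
    have hn₁ : ¬ E.Acc Z a k₁ := fun h => absurd
      (h₁.le hout₁ hr₁ (Finset.subset_insert _ _) le_rfl h hrk₁) (not_le.2 hki₁)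
    have hn₂ : ¬ E.Acc Z a k₂ := fun h => absurd
      (h₂.le hout₂ hr₂ (Finset.subset_insert _ _) heq.le h hrk₂) (not_le.2 hki₂)
    -- Here `p₁`, `p₂` are the edges from which `k₁`, `k₂` were displaced. By bareness `k₂` is
    -- refused when `lv k₁` closes at time `a`, so `lv k₂` holds an earlier edge there. After `p₁`
    -- this run closes the same vertices as the one at `a + 1`, where `k₂` is accepted; hence the
    -- held edge lies before `p₁` and is `p₂`. By symmetry also `p₁ < p₂`, a contradiction.
    have key : ∀ k₁ k₂ p₁ p₂, (∀ k, E.Acc (insert (E.lv k₁) Z) a k → E.rv k = r → i₁ ≤ k) →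
        E.lv k₁ ∉ Z → E.Acc Z (a + 1) k₁ → E.Acc Z (a + 1) k₂ → ¬ E.Acc Z a k₁ → k₂ < i₁ →
        E.rv k₂ = r → E.tm k₂ ≤ a →
        E.lv k₁ ≠ E.lv k₂ → E.Acc Z a p₁ → E.lv p₁ = E.lv k₁ → E.Acc Z a p₂ →
        E.lv p₂ = E.lv k₂ →
        (∀ j, p₁ < j → ∀ r, E.Cl Z (a + 1) r j ↔ E.Cl (insert (E.lv k₁) Z) a r j) →
        p₂ < p₁ := by
      intro k₁ k₂ p₁ p₂ hb hkZ hk₁ hk₂ hn hlt hr htm hne hp₁ hl₁ hp₂ hl₂ hiff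
      have hcl : ∀ r j, E.Cl (insert (E.lv k₁) Z) a r j → E.Cl Z (a + 1) r j :=
        cl_lose (Nat.le_succ a) fun p hp h1 h2 => hn (h2.eq hk₁ hp ▸ h1)
      have hn' : ¬ E.Acc (insert (E.lv k₁) Z) a k₂ := fun h =>
        absurd (hb k₂ h hr) (not_le.2 hlt)
      have ht : E.Tk (insert (E.lv k₁) Z) a (E.lv k₂) k₂ := by
        by_contra ht
        exact hn' (acc_iff.2 ⟨htm, ht, fun h => hk₂.not_cl (hcl _ _ h)⟩)
      obtain ⟨p, hp, hpa, hpl⟩ := ht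
      have hpp : p ≤ p₁ := by
        by_contra hpp
        push Not at hpp
        refine hk₂.not_tk ?_
        by_contra ht
        refine ht ⟨p, hp, acc_iff.2 ⟨hpa.tm_le.trans (Nat.le_succ a), ?_, ?_⟩, hpl⟩
        · exact fun h => ht (hpl ▸ h.mono hp.le)
        · rw [hiff p hpp]
          exact hpa.not_cl
      have hpZ : E.Acc Z a p := by
        rw [hp₁.insert_iff hpp, hl₁]
        exact hpa
      have hpp₂ : p = p₂ := hpZ.eq hp₂ (hpl.trans hl₂.symm)
      have hne' : p ≠ p₁ := fun h => hne (by rw [← hl₁, ← h, hpl])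
      omega
    have hb₁ : ∀ k, E.Acc (insert (E.lv k₁) Z) a k → E.rv k = r → i₁ ≤ k := fun k hk hkr =>
      h₁.le hout₁ hr₁ subset_rfl le_rfl hk hkr
    have hb₂ : ∀ k, E.Acc (insert (E.lv k₂) Z) a k → E.rv k = r → i₁ ≤ k := fun k hk hkr =>
      h₂.le hout₂ hr₂ subset_rfl heq.le hk hkr
    by_contra hne
    have hne' : E.lv k₁ ≠ E.lv k₂ := fun h => hne (by rw [h])
    have htm : ∀ k, E.stepVertex (a + 1) ∈ Z → E.lv k ∉ Z → E.Acc Z (a + 1) k → E.tm k ≤ a := by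
      intro k hq hkZ hk
      by_contra h
      have h' : E.tm k = a + 1 := le_antisymm hk.tm_le (not_le.1 h)
      exact hkZ (lv_eq_stepVertex (Nat.succ_pos a) h' ▸ hq)
    -- A displacement forces the step vertex into `Z`, while a late vertex that was not displaced is
    -- itself the step vertex, outside `Z`. So the two cases cannot mix, and in the undisplaced case
    -- both vertices coincide.
    rcases late_cases hkZ₁ hk₁ hn₁ with ⟨p₁, hp₁, hl₁, ha₁, -, hq₁, hiff₁⟩ | ⟨hq₁, -⟩
    · rcases late_cases hkZ₂ hk₂ hn₂ with ⟨p₂, hp₂, hl₂, ha₂, -, hq₂, hiff₂⟩ | ⟨hq₂, -⟩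
      · have h1 := key k₁ k₂ p₁ p₂ hb₁ hkZ₁ hk₁ hk₂ hn₁ hki₂ hrk₂ (htm k₂ hq₁ hkZ₂ hk₂) hne'
          ha₁ hl₁ ha₂ hl₂ hiff₁
        have h2 := key k₂ k₁ p₂ p₁ hb₂ hkZ₂ hk₂ hk₁ hn₂ hki₁ hrk₁ (htm k₁ hq₁ hkZ₁ hk₁) hne'.symm
          ha₂ hl₂ ha₁ hl₁ hiff₂
        omega
      · exact hkZ₂ (hq₂ ▸ hq₁)
    · rcases late_cases hkZ₂ hk₂ hn₂ with ⟨p₂, hp₂, hl₂, ha₂, -, hq₂, hiff₂⟩ | ⟨hq₂, -⟩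
      · exact hkZ₁ (hq₁ ▸ hq₂)
      · exact hne' (hq₁.trans hq₂.symm)

end StoppedEdges

/-! ### Charging by relations, and two numerical facts -/

/-- Stands in for an explicit injection: each source has some admissible target, and a target
determines its source. -/
theorem Finset.sum_le_sum_of_rel {ι κ : Type*} {s : Finset ι} {t : Finset κ} {f : ι → ℝ}
    {g : κ → ℝ} (R : ι → κ → Prop) (hg : ∀ y ∈ t, 0 ≤ g y)
    (h : ∀ x ∈ s, ∃ y ∈ t, R x y ∧ f x ≤ g y)
    (hinj : ∀ x ∈ s, ∀ x' ∈ s, ∀ y, R x y → R x' y → x = x') :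
    ∑ x ∈ s, f x ≤ ∑ y ∈ t, g y := by
  classical
  rcases s.eq_empty_or_nonempty with rfl | ⟨x₀, hx₀⟩
  · simpa using Finset.sum_nonneg hg
  have : Nonempty κ := ⟨(h x₀ hx₀).choose⟩
  choose! φ hφ using h
  have h1 : Set.InjOn φ s := fun x hx x' hx' he =>
    hinj x hx x' hx' (φ x) (hφ x hx).2.1 (he ▸ (hφ x' hx').2.1)
  calc ∑ x ∈ s, f x ≤ ∑ x ∈ s, g (φ x) := Finset.sum_le_sum fun x hx => (hφ x hx).2.2
    _ = ∑ y ∈ s.image φ, g y := (Finset.sum_image h1).symm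
    _ ≤ ∑ y ∈ t, g y := Finset.sum_le_sum_of_subset_of_nonneg
        (fun y hy => by
          obtain ⟨x, hx, rfl⟩ := Finset.mem_image.1 hy
          exact (hφ x hx).1) fun y hy _ => hg y hy

theorem Finset.card_le_card_of_rel {ι κ : Type*} {s : Finset ι} {t : Finset κ}
    (R : ι → κ → Prop) (h : ∀ x ∈ s, ∃ y ∈ t, R x y)
    (hinj : ∀ x ∈ s, ∀ x' ∈ s, ∀ y, R x y → R x' y → x = x') : s.card ≤ t.card := by
  have := Finset.sum_le_sum_of_rel (f := fun _ => 1) (g := fun _ => 1) R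
    (fun _ _ => zero_le_one) (fun x hx => (h x hx).imp fun y hy => ⟨hy.1, hy.2, le_rfl⟩) hinj
  simpa using this

/-- The law of the number of trials until a success, truncated after the elements of `L`. -/
theorem Finset.geometric_sum_rank (u : ℝ) (L : Finset ℕ) :
    (1 - u) ^ L.card + u * ∑ i ∈ L, (1 - u) ^ (L.filter (· < i)).card = 1 := by
  classical
  induction L using Finset.induction_on_max with
  | empty => simp
  | insert a L hlt ih =>
    have ha : a ∉ L := fun h => lt_irrefl a (hlt a h)
    rw [Finset.sum_insert ha, Finset.card_insert_of_notMem ha]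
    have h1 : (insert a L).filter (· < a) = L := by
      ext k
      simp only [Finset.mem_filter, Finset.mem_insert]
      exact ⟨fun h => h.1.resolve_left h.2.ne, fun h => ⟨Or.inr h, hlt k h⟩⟩
    have h2 : ∀ i ∈ L, (insert a L).filter (· < i) = L.filter (· < i) := by
      intro i hi
      rw [Finset.filter_insert, if_neg (hlt i hi).le.not_gt]
    rw [h1, Finset.sum_congr rfl fun i hi => by rw [h2 i hi]]
    rw [pow_succ]
    linarith

/-- A minorant of the matching probability by powers of `1 - u`, for the two values `u = 1/6` and `u
= 1/2` used in `card_heavy_le`. From `k = 5` on, both `(1 + k) (1 - u) ^ k` decrease. -/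
theorem le_inv_succ (k : ℕ) :
    (1 / 3 : ℝ) * ((1 - 1 / 6) ^ k + (1 - 1 / 2) ^ k) ≤ 1 / (1 + k) := by
  rw [le_div_iff₀ (by positivity)]
  rcases Nat.lt_or_ge k 5 with hk | hk
  · interval_cases k <;> norm_num
  · have h1 : ((5 : ℝ) / 6) ^ k * (1 + k) ≤ (5 / 6) ^ 5 * 6 := by
      induction k, hk using Nat.le_induction with
      | base => norm_num
      | succ k hk ih =>
        have hk' : (5 : ℝ) ≤ k := by exact_mod_cast hk
        have hp : (0 : ℝ) ≤ (5 / 6) ^ k := by positivity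
        refine le_trans ?_ ih
        rw [pow_succ]
        push_cast
        nlinarith
    have h2 : ((1 : ℝ) / 2) ^ k * (1 + k) ≤ (1 / 2) ^ 5 * 6 := by
      clear h1
      induction k, hk using Nat.le_induction with
      | base => norm_num
      | succ k hk ih =>
        have hk' : (5 : ℝ) ≤ k := by exact_mod_cast hk
        have hp : (0 : ℝ) ≤ (1 / 2) ^ k := by positivity
        refine le_trans ?_ ih
        rw [pow_succ]
        push_cast
        nlinarith
    have e1 : (1 : ℝ) - 1 / 6 = 5 / 6 := by norm_num
    have e2 : (1 : ℝ) - 1 / 2 = 1 / 2 := by norm_num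
    rw [e1, e2]
    norm_num at h1 h2 ⊢
    nlinarith

/-! ### Moving a light vertex into the sample -/

namespace StoppedEdges

open TimedEdges

variable {α β : Type*} (E : StoppedEdges α β)

open scoped Classical in
/-- The edges of left vertices outside of `S` which `r` has received from the edge `j` on. -/
noncomputable def lights (r : β) (j : ℕ) (S : Finset α) : Finset ℕ :=
  (Finset.range E.size).filter fun i => j ≤ i ∧ E.Out S i ∧ E.rv i = r ∧ E.lv i ∉ S

variable {E} {S S' S₁ S₂ Q Z W : Finset α} {s s' a a' i i' j j' k : ℕ} {r : β} {l x y : α}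

theorem Out.lt_size (h : E.Out S i) : i < E.size := by
  by_contra hi
  have := E.lt_tm i (not_lt.1 hi)
  have := h.tm_le
  have := E.exit_le (S := S)
  omega

open scoped Classical in
theorem mem_lights : i ∈ E.lights r j S ↔ j ≤ i ∧ E.Out S i ∧ E.rv i = r ∧ E.lv i ∉ S := by
  rw [lights, Finset.mem_filter, Finset.mem_range]
  exact ⟨fun h => h.2, fun h => ⟨h.2.1.lt_size, h⟩⟩

variable [DecidableEq α]

/-- A light vertex `lv k` does not exit before a firm vertex at `r`. -/
theorem Firm.exit_le_exit (hf : E.Firm S i) (hk : E.Out S k) (hr : E.rv i = E.rv k)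
    (hik : i < k) : E.exit (insert (E.lv i) S) ≤ E.exit (insert (E.lv k) S) := by
  by_contra hlt
  push Not at hlt
  have hk' := (frozen_exit' hlt exit_insert_le (Or.inr hk)).1
  exact absurd (le_exit exit_le fun hd =>
    alive_exit (E.dead_mono _ _ _ _ le_rfl (cl_swap hf.2.2 hk' hr hik) hd)) (not_le.2 hlt)

/-- Once `lv i` closes, rivals after `i` are shut out, while the earlier firm edge at `r` is still
held since the new exit lies between its two reference exits. A rival before `i` that was not light
for `Z` would have found `r` closed before `i`, contradicting that `i` is accepted when `Z` exits.
-/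
theorem Firm.ajar_insert (hZ : E.Heavy r j Z) (hi : i ∈ E.lights r j Z) (hf : E.Firm Z i) :
    E.Ajar r j (insert (E.lv i) Z) ∧ E.Out (insert (E.lv i) Z) i ∧
      E.lights r j (insert (E.lv i) Z) ⊆ (E.lights r j Z).filter (· < i) := by
  rw [mem_lights] at hi
  obtain ⟨hji, hout, hr, hiZ⟩ := hi
  obtain ⟨hcl, p, hpj, hpr, hp⟩ := hZ
  have hpi : p < i := hpj.trans_le hji
  have hW : E.Out (insert (E.lv i) Z) i := acc_insert_self.2 hf.2.2
  have hle := hp.exit_le_exit hout (hpr.trans hr.symm) hpi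
  have hpa := hp.2.2.between hp.2.1 hle exit_insert_le
  refine ⟨⟨fun hc => ?_, p, hpj, (hf.2.2.insert_iff hpi.le).1 hpa, hpr, ?_⟩, hW, fun k hk => ?_⟩
  · exact hW.not_cl (hr ▸ hc.mono hji)
  · rw [Finset.mem_insert]
    rintro (h | h)
    · exact hpi.ne (hp.2.1.eq hout h)
    · exact hp.1 h
  · rw [mem_lights] at hk
    obtain ⟨hjk, hk, hkr, hkW⟩ := hk
    have hki : k < i := by
      refine lt_of_le_of_ne (hW.le_closing (Finset.mem_insert_self _ _) hk (hkr.trans hr.symm)) ?_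
      rintro rfl
      exact hkW (Finset.mem_insert_self _ _)
    have hkZ : E.Acc Z (E.exit (insert (E.lv i) Z)) k := (hf.2.2.insert_iff hki.le).2 hk
    rw [Finset.mem_filter, mem_lights]
    refine ⟨⟨hjk, ?_, hkr, fun h => hkW (Finset.mem_insert_of_mem h)⟩, hki⟩
    by_contra hno
    have hc := hkZ.cl_of_not (cl_mono subset_rfl exit_insert_le) exit_insert_le hno
    exact hout.not_cl (((hkr.trans hr.symm) ▸ hc).mono hki.le)

/-- An edge that is not firm arrives exactly one step after the exit of the enlarged set. Its
acceptance at that time is what lets the edge be recovered from the enlarged set and `r`. -/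
theorem ajar_insert_of_not_firm (hZ : E.Heavy r j Z) (hi : i ∈ E.lights r j Z)
    (hf : ¬ E.Firm Z i) : E.Ajar r j (insert (E.lv i) Z) ∧
      E.Acc (insert (E.lv i) Z) (E.exit (insert (E.lv i) Z) + 1) i := by
  rw [mem_lights] at hi
  obtain ⟨hji, hout, hr, hiZ⟩ := hi
  obtain ⟨hcl, p, hpj, hpr, hp⟩ := hZ
  have hpi : p < i := hpj.trans_le hji
  have hle := hp.exit_le_exit hout (hpr.trans hr.symm) hpi
  set σ := E.exit (insert (E.lv i) Z) with hσ
  have hno : ¬ E.Acc Z σ i := fun h => hf ⟨hiZ, hout, h⟩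
  have hlt : σ < E.exit Z := by
    refine lt_of_le_of_ne exit_insert_le fun he => hno ?_
    rw [he]
    exact hout
  have hi' : E.Acc Z (σ + 1) i := (frozen_exit' (Nat.lt_succ_self _) hlt (Or.inr hout)).1
  have hcl' : ∀ r j, E.Cl (insert (E.lv i) Z) σ r j → E.Cl Z (σ + 1) r j :=
    cl_lose (Nat.le_succ σ) fun q hq h1 h2 => hno (h2.eq hi' hq ▸ h1)
  refine ⟨⟨fun hc => hi'.not_cl (hr ▸ (hcl' _ _ hc).mono hji), p, hpj, ?_, hpr, ?_⟩,
    acc_insert_self.2 hi'⟩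
  · exact Acc.sandwich (cl_mono (Finset.subset_insert _ _) le_rfl) hcl' le_rfl
      (hp.2.2.between hp.2.1 hle exit_insert_le)
      (hp.2.2.between hp.2.1 (hle.trans (Nat.le_succ _)) hlt)
  · rw [Finset.mem_insert]
    rintro (h | h)
    · exact hpi.ne (hp.2.1.eq hout h)
    · exact hp.1 h

end StoppedEdges

/-! ### Counting over all samples -/

namespace StoppedEdges

open TimedEdges

section

variable {α β : Type*} [DecidableEq α] (E : StoppedEdges α β)

/-- `r` is bare, and its closing left vertex would lose its edge. -/
def Loose (r : β) (j : ℕ) (S : Finset α) : Prop :=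
  E.Bare r j S ∧ ∃ i, i < j ∧ E.Out S i ∧ E.rv i = r ∧ E.lv i ∈ S ∧ ¬ E.Out (S.erase (E.lv i)) i

variable {E} {S S' Q Z W : Finset α} {a i j k : ℕ} {r : β}

/-- The earlier edge of an ajar vertex which is not heavy is closing soon after its left vertex is
added. -/
theorem Ajar.exists_light (h : E.Ajar r j W) (hW : ¬ E.Heavy r j W) :
    ∃ i, E.lv i ∉ W ∧ E.rv i = r ∧
      E.Acc (insert (E.lv i) W) (E.exit (insert (E.lv i) W) + 1) i ∧
      (E.lv i = E.stepVertex (E.exit (insert (E.lv i) W) + 1) ∨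
        ∃ p, E.lv p = E.lv i ∧ E.Out (insert (E.lv i) W) p ∧
          (E.Full (E.rv p) j (insert (E.lv i) W) ∨ E.Loose (E.rv p) j (insert (E.lv i) W))) := by
  obtain ⟨hcl, i, hij, hi, hr, hiW⟩ := h
  have hno : ¬ E.Acc W (E.exit (insert (E.lv i) W)) i := fun h => hW ⟨hcl, i, hij, hr, hiW, hi, h⟩
  have hlt : E.exit (insert (E.lv i) W) < E.exit W := by
    refine lt_of_le_of_ne exit_insert_le fun he => hno ?_
    rw [he]
    exact hi
  have hi' := (frozen_exit' (Nat.lt_succ_self _) hlt (Or.inr hi)).1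
  refine ⟨i, hiW, hr, acc_insert_self.2 hi', ?_⟩
  rcases late_cases hiW hi' hno with ⟨p, hp, hl, hpa, -⟩ | ⟨h, -⟩
  swap
  · exact Or.inl h
  refine Or.inr ⟨p, hl, ?_⟩
  have hpU : E.Out (insert (E.lv i) W) p := by
    rw [← hl] at hpa ⊢
    exact acc_insert_self.2 hpa
  have hpS : E.lv p ∈ insert (E.lv i) W := hl ▸ Finset.mem_insert_self _ _
  have hc : E.Closed (E.rv p) j (insert (E.lv i) W) := ⟨p, hp.trans hij, hpU, rfl, hpS⟩
  refine ⟨hpU, ?_⟩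
  by_cases hb : ∃ k, E.Out (insert (E.lv i) W) k ∧ E.rv k = E.rv p ∧ E.lv k ∉ insert (E.lv i) W
  · exact Or.inl ⟨hc, hb⟩
  · push Not at hb
    refine Or.inr ⟨⟨hc, hb⟩, p, hp.trans hij, hpU, rfl, hpS, fun h => ?_⟩
    rw [hl, Finset.erase_insert hiW] at h
    exact hp.ne (h.eq hi hl)

end

section

variable {α β : Type*} (E : StoppedEdges α β)

/-- The edges before `j` accepted by closing left vertices at the exit of `S`. -/
noncomputable def heads (j : ℕ) (S : Finset α) : Finset ℕ := E.closings S (E.exit S) j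

open scoped Classical in
/-- The edges before `j` accepted by the other left vertices at the exit of `S`. -/
noncomputable def tails (j : ℕ) (S : Finset α) : Finset ℕ :=
  (Finset.range j).filter fun i => E.Out S i ∧ E.lv i ∉ S

theorem mem_heads {j i : ℕ} {S : Finset α} :
    i ∈ E.heads j S ↔ i < j ∧ E.Out S i ∧ E.lv i ∈ S :=
  mem_closings

open scoped Classical in
theorem mem_tails {j i : ℕ} {S : Finset α} :
    i ∈ E.tails j S ↔ i < j ∧ E.Out S i ∧ E.lv i ∉ S := by
  rw [tails, Finset.mem_filter, Finset.mem_range]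

end

section

variable {α β : Type*} [Fintype α] (E : StoppedEdges α β)

open scoped Classical in
/-- The sets of left vertices with the property `P`. -/
noncomputable def sets (P : Finset α → Prop) : Finset (Finset α) := Finset.univ.filter P

theorem mem_sets {P : Finset α → Prop} {S : Finset α} : S ∈ sets P ↔ P S := by
  simp [sets]

/-- Closing edges and closed right vertices correspond. -/
theorem card_heads [Fintype β] (j : ℕ) :
    ∑ S : Finset α, (E.heads j S).card = ∑ r : β, (sets (E.Closed r j)).card := by
  classical
  have h1 : ∀ S : Finset α, (E.heads j S).card =
      (Finset.univ.filter fun r => E.Closed r j S).card := fun S => card_closings S _ j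
  simp_rw [h1, sets, Finset.card_filter]
  rw [Finset.sum_comm]

variable [DecidableEq α]

/-- The two kinds of removal share one target without collisions: `FirmRel.eq`, `LostRel.eq` and the
mixed `FirmRel.eq_of_lostRel` make the union of the relations injective. -/
theorem card_bare_le (r : β) (j : ℕ) :
    (sets (E.Bare r j)).card ≤ (sets (E.Full r j)).card + (sets (E.Heavy r j)).card := by
  classical
  refine le_trans (Finset.card_le_card_of_rel (t := sets (E.Full r j) ∪ sets (E.Heavy r j))
    (fun S Z => E.FirmRel r j S Z ∨ E.LostRel r j S Z) ?_ ?_) (Finset.card_union_le _ _)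
  · intro S hS
    obtain ⟨Z, ⟨h, h'⟩ | ⟨h, h'⟩⟩ := (mem_sets.1 hS).exists_rel
    · refine ⟨Z, Finset.mem_union.2 ?_, Or.inl h⟩
      exact h'.imp mem_sets.2 mem_sets.2
    · exact ⟨Z, Finset.mem_union_left _ (mem_sets.2 h'), Or.inr h⟩
  · intro S hS S' hS' Z h h'
    have hS := mem_sets.1 hS
    have hS' := mem_sets.1 hS'
    rcases h with h | h <;> rcases h' with h' | h'
    · exact h.eq hS hS' h'
    · exact h.eq_of_lostRel hS hS' h'
    · exact (h'.eq_of_lostRel hS' hS h).symm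
    · exact h.eq hS hS' h'

theorem card_loose_le (r : β) (j : ℕ) :
    (sets (E.Loose r j)).card ≤ (sets (E.Full r j)).card := by
  refine Finset.card_le_card_of_rel (E.LostRel r j) ?_ ?_
  · intro S hS
    obtain ⟨-, i, hij, hi, hr, hiS, hno⟩ := mem_sets.1 hS
    obtain ⟨Z, h, h'⟩ := exists_lostRel hij hi hr hiS hno
    exact ⟨Z, mem_sets.2 h', h⟩
  · intro S hS S' hS' Z h h'
    exact h.eq (mem_sets.1 hS).1 (mem_sets.1 hS').1 h'

theorem card_closed_le (r : β) (j : ℕ) :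
    (sets (E.Closed r j)).card ≤ 2 * (sets (E.Full r j)).card + (sets (E.Heavy r j)).card := by
  classical
  have h1 : sets (E.Closed r j) ⊆ sets (E.Full r j) ∪ sets (E.Bare r j) := by
    intro S hS
    have hS := mem_sets.1 hS
    rw [Finset.mem_union, mem_sets, mem_sets]
    by_cases h : ∃ i, E.Out S i ∧ E.rv i = r ∧ E.lv i ∉ S
    · exact Or.inl ⟨hS, h⟩
    · push Not at h
      exact Or.inr ⟨hS, h⟩
  have h2 := (Finset.card_le_card h1).trans (Finset.card_union_le _ _)
  have h3 := E.card_bare_le r j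
  omega

/-- Split the unit mass of each heavy set by the geometric law over its lights. Inserting a firm
light `i` leaves at most the lights before `i`, so its term is bounded by the weight of the new ajar
set; a light that is not firm is bounded by 1. The inserted vertex is the unique closing one at `r`,
at the exit or one step later, so each kind is injective. -/
theorem card_heavy_le (r : β) (j : ℕ) {u : ℝ} (hu : 0 ≤ u) (hu1 : u ≤ 1) :
    ((sets (E.Heavy r j)).card : ℝ) ≤
      (1 + u) * ∑ W ∈ sets (E.Ajar r j), (1 - u) ^ (E.lights r j W).card +
        u * (sets (E.Ajar r j)).card := by
  classical
  have hpos : ∀ k : ℕ, 0 ≤ (1 - u) ^ k := fun k => pow_nonneg (by linarith) k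
  have hle1 : ∀ k : ℕ, (1 - u) ^ k ≤ 1 := fun k => pow_le_one₀ (by linarith) (by linarith)
  have hanti : ∀ {k l : ℕ}, k ≤ l → (1 - u) ^ l ≤ (1 - u) ^ k := fun h =>
    pow_le_pow_of_le_one (by linarith) (by linarith) h
  set I := sets (E.Heavy r j)
  set X := sets (E.Ajar r j)
  have hIX : I ⊆ X := fun S hS => mem_sets.2 (mem_sets.1 hS).ajar
  set P := I.sigma fun Z => (E.lights r j Z).filter fun i => E.Firm Z i with hP
  set N := I.sigma fun Z => (E.lights r j Z).filter fun i => ¬ E.Firm Z i with hN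
  have h1 : (I.card : ℝ) = ∑ Z ∈ I, (1 - u) ^ (E.lights r j Z).card +
      u * ∑ Z ∈ I, ∑ i ∈ E.lights r j Z,
        (1 - u) ^ ((E.lights r j Z).filter (· < i)).card := by
    rw [Finset.mul_sum, ← Finset.sum_add_distrib,
      Finset.sum_congr rfl fun Z _ => Finset.geometric_sum_rank u (E.lights r j Z)]
    simp
  have h2 : ∑ Z ∈ I, (1 - u) ^ (E.lights r j Z).card ≤
      ∑ W ∈ X, (1 - u) ^ (E.lights r j W).card :=
    Finset.sum_le_sum_of_subset_of_nonneg hIX fun _ _ _ => hpos _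
  have h3 : ∑ Z ∈ I, ∑ i ∈ E.lights r j Z, (1 - u) ^ ((E.lights r j Z).filter (· < i)).card =
      ∑ p ∈ P, (1 - u) ^ ((E.lights r j p.1).filter (· < p.2)).card +
      ∑ p ∈ N, (1 - u) ^ ((E.lights r j p.1).filter (· < p.2)).card := by
    rw [hP, hN, Finset.sum_sigma, Finset.sum_sigma, ← Finset.sum_add_distrib]
    exact Finset.sum_congr rfl fun Z _ => (Finset.sum_filter_add_sum_filter_not _ _ _).symm
  have h4 : ∑ p ∈ P, (1 - u) ^ ((E.lights r j p.1).filter (· < p.2)).card ≤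
      ∑ W ∈ X, (1 - u) ^ (E.lights r j W).card := by
    refine Finset.sum_le_sum_of_rel
      (fun p W => W = insert (E.lv p.2) p.1 ∧ E.lv p.2 ∉ p.1 ∧ E.Out W p.2 ∧ E.rv p.2 = r)
      (fun _ _ => hpos _) ?_ ?_
    · rintro ⟨Z, i⟩ hp
      rw [hP, Finset.mem_sigma, Finset.mem_filter] at hp
      obtain ⟨hZ, hi, hf⟩ := hp
      obtain ⟨hA, hO, hsub⟩ := hf.ajar_insert (mem_sets.1 hZ) hi
      exact ⟨_, mem_sets.2 hA, ⟨rfl, hf.1, hO, (mem_lights.1 hi).2.2.1⟩,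
        hanti (Finset.card_le_card hsub)⟩
    · rintro ⟨Z, i⟩ - ⟨Z', i'⟩ - W ⟨h1, h2, h3, h4⟩ ⟨h1', h2', h3', h4'⟩
      dsimp only at *
      have hi : E.lv i ∈ W := h1 ▸ Finset.mem_insert_self _ _
      have hi' : E.lv i' ∈ W := h1' ▸ Finset.mem_insert_self _ _
      have he : i = i' := le_antisymm (h3'.le_closing hi' h3 (h4.trans h4'.symm))
        (h3.le_closing hi h3' (h4'.trans h4.symm))
      subst he
      have : Z = Z' := by
        rw [← Finset.erase_insert h2, ← h1, h1', Finset.erase_insert h2']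
      rw [this]
  have h5 : ∑ p ∈ N, (1 - u) ^ ((E.lights r j p.1).filter (· < p.2)).card ≤ X.card := by
    have : ∑ W ∈ X, (1 : ℝ) = X.card := by simp
    rw [← this]
    refine Finset.sum_le_sum_of_rel
      (fun p W => W = insert (E.lv p.2) p.1 ∧ E.lv p.2 ∉ p.1 ∧
        E.Acc W (E.exit W + 1) p.2 ∧ E.rv p.2 = r)
      (fun _ _ => zero_le_one) ?_ ?_
    · rintro ⟨Z, i⟩ hp
      rw [hN, Finset.mem_sigma, Finset.mem_filter] at hp
      obtain ⟨hZ, hi, hf⟩ := hp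
      obtain ⟨hA, hO⟩ := ajar_insert_of_not_firm (mem_sets.1 hZ) hi hf
      exact ⟨_, mem_sets.2 hA, ⟨rfl, (mem_lights.1 hi).2.2.2, hO, (mem_lights.1 hi).2.2.1⟩,
        hle1 _⟩
    · rintro ⟨Z, i⟩ - ⟨Z', i'⟩ - W ⟨h1, h2, h3, h4⟩ ⟨h1', h2', h3', h4'⟩
      dsimp only at *
      have hi : E.lv i ∈ W := h1 ▸ Finset.mem_insert_self _ _
      have hi' : E.lv i' ∈ W := h1' ▸ Finset.mem_insert_self _ _
      have he : i = i' := le_antisymm (h3'.le_closing hi' h3 (h4.trans h4'.symm))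
        (h3.le_closing hi h3' (h4'.trans h4.symm))
      subst he
      have : Z = Z' := by
        rw [← Finset.erase_insert h2, ← h1, h1', Finset.erase_insert h2']
      rw [this]
  rw [h3] at h1
  have h6 := mul_le_mul_of_nonneg_left (add_le_add h4 h5) hu
  linarith

/-- With `h` heavy and `a` ajar sets, `u = 1/6` bounds the sum of powers below by `(6h - a)/7` and
`u = 1/2` by `(2h - a)/3`; `le_inv_succ` takes a third of their sum. -/
theorem sum_ajar_ge (r : β) (j : ℕ) :
    (32 / 63 : ℝ) * (sets (E.Heavy r j)).card - 10 / 63 * (sets (E.Ajar r j)).card ≤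
      ∑ W ∈ sets (E.Ajar r j), 1 / (1 + ((E.lights r j W).card : ℝ)) := by
  have h1 := E.card_heavy_le r j (u := 1 / 6) (by norm_num) (by norm_num)
  have h2 := E.card_heavy_le r j (u := 1 / 2) (by norm_num) (by norm_num)
  have h3 := Finset.sum_le_sum fun W (_ : W ∈ sets (E.Ajar r j)) =>
    le_inv_succ (E.lights r j W).card
  rw [← Finset.mul_sum, Finset.sum_add_distrib] at h3
  linarith

/-- Insert the left vertex of the edge at `r` that is not firm. Either it held another edge, whose
right vertex is then full or loose, or it is the step vertex after the new exit. Right vertex and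
set, respectively the set alone, determine the inserted vertex, and its edge one step after the exit
determines `r`. Loose sets number at most the full ones. -/
theorem sum_light_le [Fintype β] (j : ℕ) :
    ∑ r, (sets (fun W => E.Ajar r j W ∧ ¬ E.Heavy r j W)).card ≤
      2 * ∑ r, (sets (E.Full r j)).card + 2 ^ Fintype.card α := by
  classical
  have h1 : ((Finset.univ : Finset β).sigma
      fun r => sets (fun W => E.Ajar r j W ∧ ¬ E.Heavy r j W)).card ≤
      (((Finset.univ : Finset β).sigma
        fun r => sets (E.Full r j) ∪ sets (E.Loose r j)).disjSum
          (Finset.univ : Finset (Finset α))).card := by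
    refine Finset.card_le_card_of_rel
      (fun (p : Σ _ : β, Finset α) (y : (Σ _ : β, Finset α) ⊕ Finset α) =>
        ∃ i, E.lv i ∉ p.2 ∧ E.rv i = p.1 ∧
        E.Acc (insert (E.lv i) p.2) (E.exit (insert (E.lv i) p.2) + 1) i ∧
        ((E.lv i = E.stepVertex (E.exit (insert (E.lv i) p.2) + 1) ∧
          y = Sum.inr (insert (E.lv i) p.2)) ∨
        ∃ k, E.lv k = E.lv i ∧ E.Out (insert (E.lv i) p.2) k ∧
          y = Sum.inl ⟨E.rv k, insert (E.lv i) p.2⟩)) ?_ ?_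
    · rintro ⟨r, W⟩ hp
      rw [Finset.mem_sigma, mem_sets] at hp
      obtain ⟨i, h1, h2, h3, h4⟩ := hp.2.1.exists_light hp.2.2
      rcases h4 with h4 | ⟨k, h4, h5, h6⟩
      · exact ⟨Sum.inr (insert (E.lv i) W), by simp, i, h1, h2, h3, Or.inl ⟨h4, rfl⟩⟩
      · refine ⟨Sum.inl ⟨E.rv k, insert (E.lv i) W⟩, ?_, i, h1, h2, h3,
          Or.inr ⟨k, h4, h5, rfl⟩⟩
        rw [Finset.inl_mem_disjSum, Finset.mem_sigma, Finset.mem_union, mem_sets, mem_sets]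
        exact ⟨Finset.mem_univ _, h6⟩
    · rintro ⟨r, W⟩ - ⟨r', W'⟩ - y ⟨i, h1, h2, h3, h4⟩ ⟨i', h1', h2', h3', h4'⟩
      dsimp only at *
      have key : E.lv i = E.lv i' → insert (E.lv i) W = insert (E.lv i') W' →
          (⟨r, W⟩ : Σ _ : β, Finset α) = ⟨r', W'⟩ := by
        intro hl hW
        rw [hW] at h3
        have he := h3.eq h3' hl
        subst he
        have : W = W' := by
          rw [← Finset.erase_insert h1, hW, Finset.erase_insert h1']
        rw [this, ← h2, ← h2']
      rcases h4 with ⟨h4, rfl⟩ | ⟨k, h4, h5, rfl⟩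
      · rcases h4' with ⟨h4', h6⟩ | ⟨k', h4', h5', h6⟩
        · have h6 := Sum.inr.inj h6
          exact key (by rw [h4, h4', h6]) h6
        · exact absurd h6 (by simp)
      · rcases h4' with ⟨h4', h6⟩ | ⟨k', h4', h5', h6⟩
        · exact absurd h6 (by simp)
        · have h6 := Sum.inl.inj h6
          obtain ⟨h7, h8⟩ := Sigma.mk.inj h6
          have h8 := eq_of_heq h8
          refine key ?_ h8
          have hk : E.lv k ∈ insert (E.lv i) W := h4 ▸ Finset.mem_insert_self _ _
          have hk' : E.lv k' ∈ insert (E.lv i') W' := h4' ▸ Finset.mem_insert_self _ _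
          rw [h8] at h5 hk
          have : k = k' := le_antisymm (h5'.le_closing hk' h5 h7)
            (h5.le_closing hk h5' h7.symm)
          rw [← h4, ← h4', this]
  rw [Finset.card_disjSum, Finset.card_sigma, Finset.card_sigma, Finset.card_univ,
    Fintype.card_finset] at h1
  refine h1.trans (Nat.add_le_add_right ?_ _)
  rw [Finset.mul_sum]
  refine Finset.sum_le_sum fun r _ => (Finset.card_union_le _ _).trans ?_
  have := E.card_loose_le r j
  omega

/-- The left vertices outside of the closing set receive at least `43 / 126` of what the closing
ones do, if each right vertex takes a random one of the edges it receives. -/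
theorem sum_closed_le [Fintype β] (j : ℕ) :
    (43 / 126 : ℝ) * ∑ r, ((sets (E.Closed r j)).card : ℝ) - 10 / 63 * 2 ^ Fintype.card α ≤
      ∑ r, (((sets (E.Full r j)).card : ℝ) +
        ∑ W ∈ sets (E.Ajar r j), 1 / (1 + ((E.lights r j W).card : ℝ))) := by
  classical
  have h1 : ∀ r, ((sets (E.Ajar r j)).card : ℝ) = (sets (E.Heavy r j)).card +
      (sets (fun W => E.Ajar r j W ∧ ¬ E.Heavy r j W)).card := by
    intro r
    rw [← Nat.cast_add, ← Finset.card_union_of_disjoint]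
    · congr 2
      ext W
      rw [Finset.mem_union, mem_sets, mem_sets, mem_sets]
      constructor
      · intro h
        by_cases hW : E.Heavy r j W
        · exact Or.inl hW
        · exact Or.inr ⟨h, hW⟩
      · exact fun h => h.elim Heavy.ajar fun h => h.1
    · rw [Finset.disjoint_left]
      intro W h h'
      exact (mem_sets.1 h').2 (mem_sets.1 h)
  have h2 : ∀ r, ((sets (E.Closed r j)).card : ℝ) ≤
      2 * (sets (E.Full r j)).card + (sets (E.Heavy r j)).card := fun r => by
    exact_mod_cast E.card_closed_le r j
  have h3 : ∑ r, ((sets (fun W => E.Ajar r j W ∧ ¬ E.Heavy r j W)).card : ℝ) ≤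
      2 * ∑ r, ((sets (E.Full r j)).card : ℝ) + 2 ^ Fintype.card α := by
    exact_mod_cast E.sum_light_le j
  -- Ajar sets are heavy or light, so the heavy ones keep 32/63 - 10/63 = 22/63 ≥ 43/126. Reserving
  -- 20/63 of the full ones to pay for the light ones leaves 43/63, twice 43/126, as closed ≤ 2 full
  -- + heavy requires.
  have h4 : ∑ r, ((43 / 126 : ℝ) * (sets (E.Closed r j)).card -
      10 / 63 * (sets (fun W => E.Ajar r j W ∧ ¬ E.Heavy r j W)).card) ≤
      ∑ r, ((((sets (E.Full r j)).card : ℝ) +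
        ∑ W ∈ sets (E.Ajar r j), 1 / (1 + ((E.lights r j W).card : ℝ))) -
          20 / 63 * ((sets (E.Full r j)).card : ℝ)) := by
    refine Finset.sum_le_sum fun r _ => ?_
    have := E.sum_ajar_ge r j
    have := h1 r
    have := h2 r
    have h0 : (0 : ℝ) ≤ (sets (E.Heavy r j)).card := Nat.cast_nonneg _
    linarith
  rw [Finset.sum_sub_distrib, ← Finset.mul_sum, ← Finset.mul_sum, Finset.sum_sub_distrib,
    ← Finset.mul_sum] at h4
  linarith

/-- On average the left vertices outside receive at most one edge more than the closing ones. -/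
theorem sum_tails_le (j : ℕ) :
    ∑ S : Finset α, (E.tails j S).card ≤
      ∑ S : Finset α, (E.heads j S).card + 2 ^ Fintype.card α := by
  classical
  have h1 : ((Finset.univ : Finset (Finset α)).sigma (E.tails j)).card ≤
      (((Finset.univ : Finset (Finset α)).sigma (E.heads j)).disjSum
        (Finset.univ : Finset (Finset α))).card := by
    refine Finset.card_le_card_of_rel
      (fun (p : Σ _ : Finset α, ℕ) (y : (Σ _ : Finset α, ℕ) ⊕ Finset α) =>
        E.lv p.2 ∉ p.1 ∧ E.Out p.1 p.2 ∧
        ((E.lv p.2 = E.stepVertex (E.exit (insert (E.lv p.2) p.1) + 1) ∧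
          y = Sum.inr (insert (E.lv p.2) p.1)) ∨
        ∃ k, E.lv k = E.lv p.2 ∧ y = Sum.inl ⟨insert (E.lv p.2) p.1, k⟩)) ?_ ?_
    · rintro ⟨S, i⟩ hp
      rw [Finset.mem_sigma, mem_tails] at hp
      obtain ⟨-, hij, hi, hiS⟩ := hp
      dsimp only at *
      -- Flip the outside vertex into the sample: it then accounts for a closing edge before `j`,
      -- unless it is the vertex whose edges appear just after the new exit.
      by_cases hex : ∃ k, k < j ∧ E.lv k = E.lv i ∧ E.Out (insert (E.lv i) S) k
      · obtain ⟨k, hkj, hk, hko⟩ := hex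
        refine ⟨Sum.inl ⟨insert (E.lv i) S, k⟩, ?_, hiS, hi, Or.inr ⟨k, hk, rfl⟩⟩
        rw [Finset.inl_mem_disjSum, Finset.mem_sigma, mem_heads]
        exact ⟨Finset.mem_univ _, hkj, hko, hk ▸ Finset.mem_insert_self _ _⟩
      · refine ⟨Sum.inr (insert (E.lv i) S), by simp, hiS, hi, Or.inl ⟨?_, rfl⟩⟩
        have hno : ¬ E.Acc S (E.exit (insert (E.lv i) S)) i := fun h =>
          hex ⟨i, hij, rfl, acc_insert_self.2 h⟩
        have hlt : E.exit (insert (E.lv i) S) < E.exit S := by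
          refine lt_of_le_of_ne exit_insert_le fun he => hno ?_
          rw [he]
          exact hi
        have hi' := (frozen_exit' (Nat.lt_succ_self _) hlt (Or.inr hi)).1
        rcases late_cases hiS hi' hno with ⟨p, hp, hl, hpa, -⟩ | ⟨h, -⟩
        · refine absurd ⟨p, hp.trans hij, hl, ?_⟩ hex
          rw [← hl] at hpa ⊢
          exact acc_insert_self.2 hpa
        · exact h
    · rintro ⟨S, i⟩ - ⟨S', i'⟩ - y ⟨h1, h2, h3⟩ ⟨h1', h2', h3'⟩
      dsimp only at *
      have key : E.lv i = E.lv i' → insert (E.lv i) S = insert (E.lv i') S' →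
          (⟨S, i⟩ : Σ _ : Finset α, ℕ) = ⟨S', i'⟩ := by
        intro hl hS
        have : S = S' := by
          rw [← Finset.erase_insert h1, hS, hl, Finset.erase_insert h1']
        subst this
        rw [h2.eq h2' hl]
      rcases h3 with ⟨h4, rfl⟩ | ⟨k, h4, rfl⟩
      · rcases h3' with ⟨h4', h6⟩ | ⟨k', h4', h6⟩
        · have h6 := Sum.inr.inj h6
          exact key (by rw [h4, h4', h6]) h6
        · exact absurd h6 (by simp)
      · rcases h3' with ⟨h4', h6⟩ | ⟨k', h4', h6⟩
        · exact absurd h6 (by simp)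
        · have h6 := Sum.inl.inj h6
          obtain ⟨h7, h8⟩ := Sigma.mk.inj h6
          have h8 := eq_of_heq h8
          refine key ?_ h7
          rw [← h4, ← h4', h8]
  rwa [Finset.card_disjSum, Finset.card_sigma, Finset.card_sigma, Finset.card_univ,
    Fintype.card_finset] at h1

end

end StoppedEdges

/-! ### From counts to utilities: summation by layers -/

theorem Finset.sum_layers {w : ℕ → ℝ} {N : ℕ} (hN : w N = 0) {A : Finset ℕ}
    (hA : ∀ i ∈ A, i < N) :
    ∑ i ∈ A, w i = ∑ j ∈ Finset.range N, (w j - w (j + 1)) * (A.filter (· < j + 1)).card := by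
  have h1 : ∀ i ∈ A, w i = ∑ j ∈ Finset.range N, if i < j + 1 then w j - w (j + 1) else 0 := by
    intro i hi
    have h2 : ∀ M, i ≤ M → w i - w M =
        ∑ j ∈ Finset.range M, if i < j + 1 then w j - w (j + 1) else 0 := by
      intro M hM
      induction M, hM using Nat.le_induction with
      | base =>
        rw [sub_self, Finset.sum_eq_zero]
        intro j hj
        rw [if_neg]
        have := Finset.mem_range.1 hj
        omega
      | succ M hM ih =>
        rw [Finset.sum_range_succ, ← ih, if_pos (Nat.lt_succ_of_le hM)]
        ring
    rw [← h2 N (hA i hi).le, hN, sub_zero]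
  rw [Finset.sum_congr rfl h1, Finset.sum_comm]
  refine Finset.sum_congr rfl fun j _ => ?_
  rw [← Finset.sum_filter, Finset.sum_const, nsmul_eq_mul, mul_comm]

namespace TimedEdges

variable {α β : Type*} {E : TimedEdges α β} {S S' : Finset α} {s s' i j : ℕ} {w : ℕ → ℝ} {N : ℕ}

theorem closings_filter (h : j ≤ N) : (E.closings S s N).filter (· < j) = E.closings S s j := by
  ext i
  rw [Finset.mem_filter, mem_closings, mem_closings]
  constructor
  · exact fun h => ⟨h.2, h.1.2⟩
  · exact fun h' => ⟨⟨h'.1.trans_le h, h'.2⟩, h'.1⟩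

theorem sum_closings (hN : w N = 0) : ∑ i ∈ E.closings S s N, w i =
    ∑ j ∈ Finset.range N, (w j - w (j + 1)) * (E.closings S s (j + 1)).card := by
  rw [Finset.sum_layers hN fun i hi => (mem_closings.1 hi).1]
  refine Finset.sum_congr rfl fun j hj => ?_
  rw [closings_filter (Finset.mem_range.1 hj)]

theorem sum_closings_mono [Fintype β] (hw : Antitone w) (hN : w N = 0)
    (h : ∀ r j, E.Cl S s r j → E.Cl S' s' r j) :
    ∑ i ∈ E.closings S s N, w i ≤ ∑ i ∈ E.closings S' s' N, w i := by
  classical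
  rw [sum_closings hN, sum_closings hN]
  refine Finset.sum_le_sum fun j _ => mul_le_mul_of_nonneg_left ?_
    (sub_nonneg.2 (hw (Nat.le_succ j)))
  rw [card_closings, card_closings]
  exact_mod_cast Finset.card_le_card fun r hr =>
    Finset.mem_filter.2 ⟨Finset.mem_univ _, h r _ (Finset.mem_filter.1 hr).2⟩

/-- In every layer one time step closes at most one more right vertex, so the total grows at most by
the sum of all layers, which is the largest weight. -/
theorem sum_closings_succ_le [Fintype β] [DecidableEq α] (hw : Antitone w) (hN : w N = 0)
    (S : Finset α) (s : ℕ) :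
    ∑ i ∈ E.closings S (s + 1) N, w i ≤ ∑ i ∈ E.closings S s N, w i + w 0 := by
  classical
  have h0 : w 0 = ∑ j ∈ Finset.range N, (w j - w (j + 1)) := by
    rw [Finset.sum_range_sub', hN, sub_zero]
  rw [sum_closings hN, sum_closings hN, h0, ← Finset.sum_add_distrib]
  refine Finset.sum_le_sum fun j _ => ?_
  rw [← mul_add_one]
  refine mul_le_mul_of_nonneg_left ?_ (sub_nonneg.2 (hw (Nat.le_succ j)))
  rw [card_closings, card_closings]
  obtain ⟨r₀, hr₀⟩ := cl_step (E := E) S s (j + 1)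
  have : (Finset.univ.filter fun r => E.Cl S (s + 1) r (j + 1)) ⊆
      insert r₀ (Finset.univ.filter fun r => E.Cl S s r (j + 1)) := by
    intro r hr
    rcases hr₀ r (Finset.mem_filter.1 hr).2 with h | h
    · exact Finset.mem_insert_of_mem (Finset.mem_filter.2 ⟨Finset.mem_univ _, h⟩)
    · exact h ▸ Finset.mem_insert_self _ _
  exact_mod_cast (Finset.card_le_card this).trans (Finset.card_insert_le _ _)

end TimedEdges

namespace StoppedEdges

open TimedEdges

variable {α β : Type*} (E : StoppedEdges α β) {w : ℕ → ℝ} {N : ℕ}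

theorem tails_filter {j : ℕ} (h : j ≤ N) (S : Finset α) :
    (E.tails N S).filter (· < j) = E.tails j S := by
  ext i
  rw [Finset.mem_filter, mem_tails, mem_tails]
  constructor
  · exact fun h => ⟨h.2, h.1.2⟩
  · exact fun h' => ⟨⟨h'.1.trans_le h, h'.2⟩, h'.1⟩

variable [Fintype α] [DecidableEq α]

theorem sum_sum_tails_le (hw : Antitone w) (hN : w N = 0) :
    ∑ S : Finset α, ∑ i ∈ E.tails N S, w i ≤
      ∑ S : Finset α, ∑ i ∈ E.heads N S, w i + 2 ^ Fintype.card α * w 0 := by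
  have h0 : w 0 = ∑ j ∈ Finset.range N, (w j - w (j + 1)) := by
    rw [Finset.sum_range_sub', hN, sub_zero]
  have h1 : ∀ S : Finset α, ∑ i ∈ E.tails N S, w i =
      ∑ j ∈ Finset.range N, (w j - w (j + 1)) * (E.tails (j + 1) S).card := by
    intro S
    rw [Finset.sum_layers hN fun i hi => (E.mem_tails.1 hi).1]
    refine Finset.sum_congr rfl fun j hj => ?_
    rw [E.tails_filter (Finset.mem_range.1 hj)]
  have h2 : ∀ S : Finset α, ∑ i ∈ E.heads N S, w i =
      ∑ j ∈ Finset.range N, (w j - w (j + 1)) * (E.heads (j + 1) S).card := fun S =>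
    sum_closings hN
  rw [Finset.sum_congr rfl fun S _ => h1 S, Finset.sum_congr rfl fun S _ => h2 S,
    Finset.sum_comm, Finset.sum_comm (s := Finset.univ), h0, Finset.mul_sum,
    ← Finset.sum_add_distrib]
  refine Finset.sum_le_sum fun j _ => ?_
  rw [← Finset.mul_sum, ← Finset.mul_sum, mul_comm (2 ^ _ : ℝ), ← mul_add]
  refine mul_le_mul_of_nonneg_left ?_ (sub_nonneg.2 (hw (Nat.le_succ j)))
  exact_mod_cast E.sum_tails_le (j + 1)

end StoppedEdges

/-! ### The market as a stopped process -/

namespace Market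

open TimedEdges StoppedEdges

variable {n m : ℕ} (G : Market n m) (e₀ : Fin n × Fin m)

/-- The `i`-th edge, and `e₀` if there is none. -/
def nth (i : ℕ) : Fin n × Fin m := G.edges.getD i e₀

open scoped Classical in
/-- The utility of the `i`-th edge, and `0` if there is none. -/
noncomputable def weight (i : ℕ) : ℝ := if h : i < G.edges.length then G.v G.edges[i] else 0

/-- The different positive values of the bucks per bang. -/
noncomputable def levels : Finset ℝ := (G.edges.toFinset.image G.bpb).filter (0 < ·)

/-- The number of levels up to `γ`. -/
noncomputable def rank (γ : ℝ) : ℕ := (G.levels.filter (· ≤ γ)).card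

variable {G e₀} {i k : ℕ} {γ γ' : ℝ}

theorem nth_eq (h : i < G.edges.length) : G.nth e₀ i = G.edges[i] := by
  rw [nth, List.getD_eq_getElem _ _ h]

theorem nth_mem (h : i < G.edges.length) : G.nth e₀ i ∈ G.edges := by
  rw [nth_eq h]
  exact List.getElem_mem h

theorem nth_inj (hi : i < G.edges.length) (hk : k < G.edges.length)
    (h : G.nth e₀ i = G.nth e₀ k) : i = k := by
  rw [nth_eq hi, nth_eq hk] at h
  exact (G.nodup.getElem_inj_iff).1 h

theorem exists_nth {e : Fin n × Fin m} (he : e ∈ G.edges) :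
    ∃ i, i < G.edges.length ∧ G.nth e₀ i = e := by
  obtain ⟨i, hi, h⟩ := List.getElem_of_mem he
  exact ⟨i, hi, (nth_eq hi).trans h⟩

theorem idxOf_nth (hi : i < G.edges.length) : G.edges.idxOf (G.nth e₀ i) = i := by
  rw [nth_eq hi]
  exact G.nodup.idxOf_getElem i hi

theorem weight_eq (h : i < G.edges.length) : G.weight i = G.v (G.nth e₀ i) := by
  rw [weight, dif_pos h, nth_eq h]

theorem weight_length : G.weight G.edges.length = 0 := by
  rw [weight, dif_neg (lt_irrefl _)]

theorem weight_antitone : Antitone G.weight := by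
  intro i k hik
  by_cases hk : k < G.edges.length
  · rw [weight, weight, dif_pos hk, dif_pos (hik.trans_lt hk)]
    rcases hik.eq_or_lt with rfl | h
    · exact le_rfl
    · exact List.pairwise_iff_getElem.1 G.sorted i k (hik.trans_lt hk) hk h
  · rw [weight, weight, dif_neg hk]
    split_ifs with h
    · exact (G.v_pos _ (List.getElem_mem h)).le
    · exact le_rfl

theorem weight_nonneg (i : ℕ) : 0 ≤ G.weight i := by
  rw [weight]
  split_ifs with h
  · exact (G.v_pos _ (List.getElem_mem h)).le
  · exact le_rfl

theorem bpb_nonneg {e : Fin n × Fin m} (he : e ∈ G.edges) : 0 ≤ G.bpb e :=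
  div_nonneg (G.c_nonneg _) (G.v_pos e he).le

theorem rank_mono (h : γ ≤ γ') : G.rank γ ≤ G.rank γ' :=
  Finset.card_le_card fun _ hx => Finset.mem_filter.2
    ⟨(Finset.mem_filter.1 hx).1, (Finset.mem_filter.1 hx).2.trans h⟩

theorem rank_le_card : G.rank γ ≤ G.levels.card := Finset.card_filter_le _ _

theorem rank_zero : G.rank 0 = 0 := by
  rw [rank, Finset.card_eq_zero, Finset.filter_eq_empty_iff]
  intro x hx
  exact not_le.2 (Finset.mem_filter.1 hx).2

theorem bpb_le_iff {e : Fin n × Fin m} (he : e ∈ G.edges) (hγ : 0 ≤ γ) :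
    G.bpb e ≤ γ ↔ G.rank (G.bpb e) ≤ G.rank γ := by
  refine ⟨rank_mono, fun h => ?_⟩
  by_contra hlt
  push Not at hlt
  refine absurd h (not_le.2 (Finset.card_lt_card ?_))
  rw [Finset.ssubset_iff_of_subset]
  · refine ⟨G.bpb e, Finset.mem_filter.2 ⟨Finset.mem_filter.2 ⟨Finset.mem_image_of_mem _
      (List.mem_toFinset.2 he), hγ.trans_lt hlt⟩, le_rfl⟩, fun h' => ?_⟩
    exact absurd (Finset.mem_filter.1 h').2 (not_le.2 hlt)
  · exact fun x hx => Finset.mem_filter.2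
      ⟨(Finset.mem_filter.1 hx).1, (Finset.mem_filter.1 hx).2.trans hlt.le⟩

variable (G e₀)

open scoped Classical in
/-- The time at which the `i`-th edge becomes available. -/
noncomputable def time (i : ℕ) : ℕ :=
  -- Zero bids all get time 0, which `lv_eq` exempts. Indices beyond the list get distinct times
  -- after the horizon, so they never become available.
  if i < G.edges.length then G.rank (G.bpb (G.nth e₀ i)) else G.levels.card + 1 + i

variable {G e₀}

theorem time_eq (h : i < G.edges.length) : G.time e₀ i = G.rank (G.bpb (G.nth e₀ i)) := by
  rw [time, if_pos h]

theorem time_of_le (h : G.edges.length ≤ i) : G.time e₀ i = G.levels.card + 1 + i := by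
  rw [time, if_neg (not_lt.2 h)]

theorem time_le (hik : i < k) (h : (G.nth e₀ i).1 = (G.nth e₀ k).1) :
    G.time e₀ i ≤ G.time e₀ k := by
  by_cases hk : k < G.edges.length
  · have hi := hik.trans hk
    rw [time_eq hk, time_eq hi]
    refine rank_mono ?_
    rw [bpb, bpb, h]
    have h1 := weight_antitone (G := G) hik.le
    rw [weight_eq (e₀ := e₀) hk, weight_eq (e₀ := e₀) hi] at h1
    exact div_le_div_of_nonneg_left (G.c_nonneg _) (G.v_pos _ (nth_mem hk)) h1
  · rw [time_of_le (not_lt.1 hk)]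
    by_cases hi : i < G.edges.length
    · rw [time_eq hi]
      have := rank_le_card (G := G) (γ := G.bpb (G.nth e₀ i))
      omega
    · rw [time_of_le (not_lt.1 hi)]
      omega

theorem fst_eq_of_time_eq (hD : G.DistinctBpb) (h : G.time e₀ i = G.time e₀ k)
    (hpos : 0 < G.time e₀ i) : (G.nth e₀ i).1 = (G.nth e₀ k).1 := by
  by_cases hi : i < G.edges.length <;> by_cases hk : k < G.edges.length
  · rw [time_eq hi] at h hpos
    rw [time_eq hk] at h
    by_contra hne
    have h1 := (bpb_le_iff (nth_mem (e₀ := e₀) hi) (bpb_nonneg (nth_mem (e₀ := e₀) hk))).2 h.le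
    have h2 := (bpb_le_iff (nth_mem (e₀ := e₀) hk) (bpb_nonneg (nth_mem (e₀ := e₀) hi))).2 h.ge
    refine hD _ (nth_mem hi) _ (nth_mem hk) hne (fun hc => ?_) (le_antisymm h1 h2)
    rw [bpb, hc, zero_div, rank_zero] at hpos
    exact lt_irrefl _ hpos
  · rw [time_eq hi, time_of_le (not_lt.1 hk)] at h
    have := rank_le_card (G := G) (γ := G.bpb (G.nth e₀ i))
    omega
  · rw [time_eq hk, time_of_le (not_lt.1 hi)] at h
    have := rank_le_card (G := G) (γ := G.bpb (G.nth e₀ k))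
    omega
  · rw [time_of_le (not_lt.1 hk), time_of_le (not_lt.1 hi)] at h
    have : i = k := by omega
    rw [this]

/-- The edges in the fixed order, becoming available by increasing buck per bang. -/
noncomputable def timed (e₀ : Fin n × Fin m) (hD : G.DistinctBpb) :
    TimedEdges (Fin n) (Fin m) where
  lv i := (G.nth e₀ i).1
  rv i := (G.nth e₀ i).2
  tm := G.time e₀
  tm_le _ _ := time_le
  lv_eq _ _ := fst_eq_of_time_eq hD

/-- The closing set `S` is dead once the budget is exceeded. -/
noncomputable def stopped (e₀ : Fin n × Fin m) (hD : G.DistinctBpb) (C : ℝ) (hC : 0 < C) :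
    StoppedEdges (Fin n) (Fin m) where
  toTimedEdges := timed e₀ hD
  -- Testing all levels passed so far, rather than the current one alone, makes deadness monotone.
  dead S s := ∃ i, i < G.edges.length ∧ G.time e₀ i ≤ s ∧
    C < G.bpb (G.nth e₀ i) * ∑ k ∈ (timed e₀ hD).closings S s G.edges.length, G.weight k
  horizon := G.levels.card
  size := G.edges.length
  lt_tm i hi := by
    change _ < G.time e₀ i
    rw [time_of_le hi]
    omega
  alive_zero S := by
    rintro ⟨i, hi, h, h'⟩
    have h1 : G.bpb (G.nth e₀ i) ≤ 0 := by
      rw [bpb_le_iff (nth_mem hi) le_rfl, rank_zero, ← time_eq hi]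
      exact h
    have h2 := Finset.sum_nonneg fun k
      (_ : k ∈ (timed e₀ hD).closings S 0 G.edges.length) => G.weight_nonneg k
    nlinarith
  dead_mono S S' s s' hs h := by
    rintro ⟨i, hi, h1, h2⟩
    exact ⟨i, hi, h1.trans hs, h2.trans_le (mul_le_mul_of_nonneg_left
      (sum_closings_mono weight_antitone weight_length h) (bpb_nonneg (nth_mem hi)))⟩

section

variable {hD : G.DistinctBpb} {C : ℝ} {hC : 0 < C} {S : Finset (Fin n)} {s : ℕ}

open scoped Classical in
-- Vertices outside `S` close nothing, so the accepted edges of `S` evolve on their own, exactly as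
-- greedy on the subgraph of `S`.
theorem greedy_take_filter (p : Fin n × Fin m → Bool)
    (hp : ∀ i, i < G.edges.length →
      (p (G.nth e₀ i) = true ↔ (G.nth e₀ i).1 ∈ S ∧ G.time e₀ i ≤ s)) :
    ∀ k, k ≤ G.edges.length → greedy ((G.edges.take k).filter p) =
      ((timed e₀ hD).closings S s k).image (G.nth e₀) := by
  intro k
  induction k with
  | zero =>
    intro _
    simp [greedy, closings]
  | succ k ih =>
    intro hk
    have hk' : k < G.edges.length := hk
    have ih := ih hk'.le
    have hsucc : (timed e₀ hD).closings S s (k + 1) = if (timed e₀ hD).Acc S s k ∧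
        (timed e₀ hD).lv k ∈ S then insert k ((timed e₀ hD).closings S s k)
        else (timed e₀ hD).closings S s k := by
      rw [closings, Finset.range_add_one, Finset.filter_insert]
      split_ifs <;> rfl
    have hgr : greedy ((G.edges.take (k + 1)).filter p) =
        if p (G.nth e₀ k) then addEdge (greedy ((G.edges.take k).filter p)) (G.nth e₀ k)
        else greedy ((G.edges.take k).filter p) := by
      rw [List.take_succ_eq_append_getElem hk', ← nth_eq (e₀ := e₀) hk', List.filter_append,
        greedy, List.foldl_append]
      by_cases h : p (G.nth e₀ k) = true
      · rw [if_pos h, List.filter_cons_of_pos h]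
        rfl
      · rw [if_neg h, List.filter_cons_of_neg h]
        rfl
    rw [hgr, hsucc, ih]
    by_cases hpk : p (G.nth e₀ k) = true
    · obtain ⟨h1, h2⟩ := (hp k hk').1 hpk
      have hfit : Fits (((timed e₀ hD).closings S s k).image (G.nth e₀)) (G.nth e₀ k) ↔
          (timed e₀ hD).Acc S s k := by
        rw [acc_iff]
        constructor
        · intro h
          refine ⟨h2, ?_, ?_⟩
          · rintro ⟨i, hi, ha, hl⟩
            exact (h _ (Finset.mem_image_of_mem _ (mem_closings.2 ⟨hi, ha, hl ▸ h1⟩))).1 hl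
          · rintro ⟨i, hi, ha, hr, hS⟩
            exact (h _ (Finset.mem_image_of_mem _ (mem_closings.2 ⟨hi, ha, hS⟩))).2 hr
        · rintro ⟨-, h3, h4⟩ f hf
          obtain ⟨i, hi, rfl⟩ := Finset.mem_image.1 hf
          obtain ⟨hi, ha, hS⟩ := mem_closings.1 hi
          exact ⟨fun h => h3 ⟨i, hi, ha, h⟩, fun h => h4 ⟨i, hi, ha, h, hS⟩⟩
      rw [if_pos hpk, addEdge]
      by_cases hA : (timed e₀ hD).Acc S s k
      · rw [if_pos (hfit.2 hA), if_pos ⟨hA, h1⟩, Finset.image_insert]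
      · rw [if_neg (fun h => hA (hfit.1 h)), if_neg fun h => hA h.1]
    · rw [if_neg hpk, if_neg]
      exact fun h => hpk ((hp k hk').2 ⟨h.2, h.1.tm_le⟩)

theorem greedy_filter (p : Fin n × Fin m → Bool)
    (hp : ∀ i, i < G.edges.length →
      (p (G.nth e₀ i) = true ↔ (G.nth e₀ i).1 ∈ S ∧ G.time e₀ i ≤ s)) :
    greedy (G.edges.filter p) =
      ((timed e₀ hD).closings S s G.edges.length).image (G.nth e₀) := by
  have := greedy_take_filter (hD := hD) p hp _ le_rfl
  rwa [List.take_length] at this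

theorem sum_image_nth {A : Finset ℕ} (hA : ∀ i ∈ A, i < G.edges.length) :
    ∑ e ∈ A.image (G.nth e₀), G.v e = ∑ i ∈ A, G.weight i := by
  rw [Finset.sum_image fun i hi k hk h => nth_inj (hA i hi) (hA k hk) h]
  exact Finset.sum_congr rfl fun i hi => (weight_eq (hA i hi)).symm

theorem sum_greedy_subEdges (hγ : 0 ≤ γ) :
    ∑ e ∈ greedy (G.subEdges S γ), γ * G.v e =
      γ * ∑ i ∈ (timed e₀ hD).closings S (G.rank γ) G.edges.length, G.weight i := by
  rw [← Finset.mul_sum, subEdges, greedy_filter (e₀ := e₀) (hD := hD) (S := S) (s := G.rank γ),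
    sum_image_nth fun i hi => (mem_closings.1 hi).1]
  intro i hi
  rw [decide_eq_true_iff, time_eq hi, bpb_le_iff (nth_mem hi) hγ]

/-- An edge survives if and only if it becomes available before the exit. -/
theorem survives_iff_time_le (hi : i < G.edges.length) :
    G.Survives C S (G.nth e₀ i) ↔ G.time e₀ i ≤ (stopped e₀ hD C hC).exit S := by
  have hb := bpb_nonneg (nth_mem (e₀ := e₀) hi)
  constructor
  · rintro ⟨γ, hγ, hle⟩
    have hγ0 := hb.trans hle
    rw [admissible, Set.mem_ofPred_eq, sum_greedy_subEdges (e₀ := e₀) (hD := hD) hγ0] at hγ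
    refine le_exit ?_ ?_
    · rw [time_eq hi]
      exact rank_le_card
    · rintro ⟨k, hk, hki, hlt⟩
      have h1 : G.bpb (G.nth e₀ k) ≤ γ := by
        refine le_trans ?_ hle
        rw [bpb_le_iff (nth_mem hk) hb, ← time_eq hk, ← time_eq hi]
        exact hki
      have h2 : G.time e₀ i ≤ G.rank γ := by
        rw [time_eq hi]
        exact rank_mono hle
      have h3 := sum_closings_mono (E := timed e₀ hD) (weight_antitone (G := G)) weight_length
        (cl_mono (subset_refl S) h2)
      have h4 : (0 : ℝ) ≤ ∑ k ∈ (timed e₀ hD).closings S (G.time e₀ i) G.edges.length, G.weight k :=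
        Finset.sum_nonneg fun k _ => weight_nonneg k
      exact absurd (hlt.trans_le ((mul_le_mul h1 h3 h4 hγ0).trans hγ)) (lt_irrefl _)
  · intro h
    -- The admissible threshold is the buck per bang of the edge itself.
    refine ⟨_, ?_, le_rfl⟩
    rw [admissible, Set.mem_ofPred_eq, sum_greedy_subEdges (e₀ := e₀) (hD := hD) hb, ← time_eq hi]
    by_contra hlt
    exact alive_of_le h ⟨i, hi, le_rfl, not_le.1 hlt⟩

open scoped Classical in
theorem thresholdMatching_eq : G.thresholdMatching C S =
    ((stopped e₀ hD C hC).heads G.edges.length S).image (G.nth e₀) := by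
  rw [thresholdMatching]
  refine greedy_filter (hD := hD) _ fun i hi => ?_
  rw [decide_eq_true_iff, survives_iff_time_le (hD := hD) (hC := hC) hi]

end

end Market

/-! ### The optimum and the algorithm in terms of accepted edges -/

namespace Market

open TimedEdges StoppedEdges

variable {n m : ℕ} {G : Market n m} {e₀ : Fin n × Fin m} {hD : G.DistinctBpb} {C : ℝ} {hC : 0 < C}
  {S : Finset (Fin n)} {i k : ℕ} {l : Fin n}

/-- The optimum in terms of the state in which `S` exits. -/
theorem opt_le (e₀ : Fin n × Fin m) (hD : G.DistinctBpb) (hC : 0 < C) (S : Finset (Fin n)) :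
    G.opt C ≤ 3 * ∑ i ∈ (stopped e₀ hD C hC).heads G.edges.length S, G.weight i +
      ∑ i ∈ (stopped e₀ hD C hC).tails G.edges.length S, G.weight i + G.weight 0 := by
  classical
  set E := stopped e₀ hD C hC with hE
  set N := G.edges.length with hN
  have hw := fun i => weight_nonneg (G := G) i
  have hh : 0 ≤ ∑ i ∈ E.heads N S, G.weight i := Finset.sum_nonneg fun i _ => hw i
  have hdisj : Disjoint (E.heads N S) (E.tails N S) := Finset.disjoint_left.2 fun i h h' =>
    (E.mem_tails.1 h').2.2 (E.mem_heads.1 h).2.2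
  refine csSup_le (Set.Nonempty.image _
    ⟨∅, by simp, by simp [IsMatching], by simpa using hC.le⟩) ?_
  rintro _ ⟨M, ⟨hME, hM, hMC⟩, rfl⟩
  -- `X` is charged to the accepted edge at the left vertex and `Y` to the closing edge at the right
  -- vertex. An edge available at the exit falls into one of them, since otherwise it would be
  -- accepted; so `Z` holds only edges above the threshold.
  set X := M.filter fun e => ∃ i ∈ E.heads N S ∪ E.tails N S, E.lv i = e.1 ∧ G.v e ≤ G.weight i
  set Y := (M.filter fun e => ¬ ∃ i ∈ E.heads N S ∪ E.tails N S,
    E.lv i = e.1 ∧ G.v e ≤ G.weight i).filter fun e =>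
      ∃ i ∈ E.heads N S, E.rv i = e.2 ∧ G.v e ≤ G.weight i
  set Z := (M.filter fun e => ¬ ∃ i ∈ E.heads N S ∪ E.tails N S,
    E.lv i = e.1 ∧ G.v e ≤ G.weight i).filter fun e =>
      ¬ ∃ i ∈ E.heads N S, E.rv i = e.2 ∧ G.v e ≤ G.weight i with hZ
  have hsplit : G.value M = ∑ e ∈ X, G.v e + (∑ e ∈ Y, G.v e + ∑ e ∈ Z, G.v e) := by
    rw [value, Finset.sum_filter_add_sum_filter_not, Finset.sum_filter_add_sum_filter_not]
  have hX : ∑ e ∈ X, G.v e ≤ ∑ i ∈ E.heads N S, G.weight i + ∑ i ∈ E.tails N S, G.weight i := by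
    rw [← Finset.sum_union hdisj]
    refine Finset.sum_le_sum_of_rel (fun e i => E.lv i = e.1) (fun i _ => hw i) ?_ ?_
    · exact fun e he => (Finset.mem_filter.1 he).2
    · intro e he e' he' i h h'
      by_contra hne
      exact (hM e (Finset.mem_filter.1 he).1 e' (Finset.mem_filter.1 he').1 hne).1 (h.symm.trans h')
  have hY : ∑ e ∈ Y, G.v e ≤ ∑ i ∈ E.heads N S, G.weight i := by
    refine Finset.sum_le_sum_of_rel (fun e i => E.rv i = e.2) (fun i _ => hw i) ?_ ?_
    · exact fun e he => (Finset.mem_filter.1 he).2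
    · intro e he e' he' i h h'
      by_contra hne
      exact (hM e (Finset.mem_filter.1 (Finset.mem_filter.1 he).1).1 e'
        (Finset.mem_filter.1 (Finset.mem_filter.1 he').1).1 hne).2 (h.symm.trans h')
  have hZM : Z ⊆ M := (Finset.filter_subset _ _).trans (Finset.filter_subset _ _)
  have htime : ∀ e ∈ Z, ∃ i, i < N ∧ G.nth e₀ i = e ∧ E.exit S < G.time e₀ i := by
    intro e he
    obtain ⟨i, hi, rfl⟩ := exists_nth (e₀ := e₀) (hME e (hZM he))
    refine ⟨i, hi, rfl, ?_⟩
    by_contra hle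
    rw [hZ, Finset.mem_filter, Finset.mem_filter] at he
    obtain ⟨⟨-, h1⟩, h2⟩ := he
    have hsub : ∀ k, k ≤ i → E.Out S k → k ∈ E.heads N S ∪ E.tails N S := fun k hk hA => by
      rw [Finset.mem_union, mem_heads, mem_tails]
      by_cases hkS : E.lv k ∈ S
      · exact Or.inl ⟨hk.trans_lt hi, hA, hkS⟩
      · exact Or.inr ⟨hk.trans_lt hi, hA, hkS⟩
    have hwk : ∀ k, k ≤ i → G.v (G.nth e₀ i) ≤ G.weight k := fun k hk => by
      rw [← weight_eq hi]
      exact weight_antitone hk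
    by_cases hA : E.Out S i
    · exact h1 ⟨i, hsub i le_rfl hA, rfl, hwk i le_rfl⟩
    · refine hA (acc_iff.2 ⟨not_lt.1 hle, ?_, ?_⟩)
      · rintro ⟨k, hk, hAk, hl⟩
        exact h1 ⟨k, hsub k hk.le hAk, hl, hwk k hk.le⟩
      · rintro ⟨k, hk, hAk, hr, hkS⟩
        exact h2 ⟨k, E.mem_heads.2 ⟨hk.trans hi, hAk, hkS⟩, hr, hwk k hk.le⟩
  have hZ' : ∑ e ∈ Z, G.v e ≤ ∑ i ∈ E.heads N S, G.weight i + G.weight 0 := by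
    rcases Z.eq_empty_or_nonempty with h0 | ⟨e, he⟩
    · rw [h0, Finset.sum_empty]
      exact add_nonneg hh (hw 0)
    · obtain ⟨i, hi, -, hlt⟩ := htime e he
      have hhor : E.exit S + 1 ≤ E.horizon := by
        refine (Nat.succ_le_of_lt hlt).trans ?_
        rw [time_eq hi]
        exact rank_le_card
      -- One step after the exit the budget is exceeded at a buck per bang no larger than that of
      -- any edge of `Z`, while `Z` costs at most `C`. So `Z` is worth less than the closing edges
      -- at that time.
      obtain ⟨k, hk, hkt, hdead⟩ := dead_of_lt (Nat.lt_succ_self _) hhor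
      have hbk := bpb_nonneg (nth_mem (e₀ := e₀) hk)
      have hcost : G.bpb (G.nth e₀ k) * ∑ e ∈ Z, G.v e ≤ C := by
        refine le_trans ?_ hMC
        refine le_trans ?_ (Finset.sum_le_sum_of_subset_of_nonneg hZM
          fun e _ _ => G.c_nonneg e.1)
        rw [Finset.mul_sum]
        refine Finset.sum_le_sum fun e he => ?_
        obtain ⟨i, hi, rfl, hlt⟩ := htime e he
        have hpos := G.v_pos _ (nth_mem (e₀ := e₀) hi)
        have h1 : G.bpb (G.nth e₀ k) ≤ G.bpb (G.nth e₀ i) := by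
          rw [bpb_le_iff (nth_mem hk) (bpb_nonneg (nth_mem hi)), ← time_eq hk, ← time_eq hi]
          exact hkt.trans hlt
        calc G.bpb (G.nth e₀ k) * G.v (G.nth e₀ i)
            ≤ G.bpb (G.nth e₀ i) * G.v (G.nth e₀ i) := mul_le_mul_of_nonneg_right h1 hpos.le
          _ = G.c (G.nth e₀ i).1 := div_mul_cancel₀ _ hpos.ne'
      have h1 := lt_of_mul_lt_mul_left (hcost.trans_lt hdead) hbk
      exact h1.le.trans (sum_closings_succ_le weight_antitone weight_length S _)
  rw [hsplit]
  linarith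

/-- An edge meets the reward of its right vertex if that is not closed before. -/
theorem meetsReward_iff (hi : i < G.edges.length) (hiS : (G.nth e₀ i).1 ∉ S) :
    G.MeetsReward C S (G.nth e₀ i) ↔ ¬ (stopped e₀ hD C hC).Closed (G.nth e₀ i).2 i S := by
  classical
  set E := stopped e₀ hD C hC
  have hT := thresholdMatching_eq (e₀ := e₀) (hD := hD) (hC := hC) (S := S)
  have hpos := (G.v_pos _ (nth_mem (e₀ := e₀) hi)).le
  by_cases hex : ∃ k ∈ E.heads G.edges.length S, E.rv k = (G.nth e₀ i).2
  · obtain ⟨k, hk, hkr⟩ := hex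
    have hk' := E.mem_heads.1 hk
    have huniq : ∀ k' ∈ E.heads G.edges.length S, E.rv k' = (G.nth e₀ i).2 → k' = k := by
      intro k' h h'
      have h := E.mem_heads.1 h
      exact le_antisymm (hk'.2.1.le_closing hk'.2.2 h.2.1 (h'.trans hkr.symm))
        (h.2.1.le_closing h.2.2 hk'.2.1 (hkr.trans h'.symm))
    have hfil : (G.thresholdMatching C S).filter (fun f => f.2 = (G.nth e₀ i).2) =
        {G.nth e₀ k} := by
      rw [hT]
      ext f
      rw [Finset.mem_filter, Finset.mem_image, Finset.mem_singleton]
      constructor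
      · rintro ⟨⟨k', h1, rfl⟩, h2⟩
        rw [huniq k' h1 h2]
      · rintro rfl
        exact ⟨⟨k, hk, rfl⟩, hkr⟩
    have hrew : G.reward C S (G.nth e₀ i).2 = G.v (G.nth e₀ k) := by
      rw [reward, hfil, Finset.sum_singleton]
    have hik : i ≠ k := by
      rintro rfl
      exact hiS hk'.2.2
    rw [MeetsReward, hrew, ← weight_eq hi, ← weight_eq hk'.1]
    -- The tie rule turns the utility test into a comparison of positions: `i` passes exactly when
    -- it precedes the edge of `M₁` at its right vertex.
    rcases lt_or_gt_of_ne hik with hlt | hlt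
    · refine iff_of_true ⟨weight_antitone hlt.le, fun f hf hfr _ => ?_⟩ ?_
      · have hf' : f = G.nth e₀ k :=
          Finset.mem_singleton.1 (hfil ▸ Finset.mem_filter.2 ⟨hf, hfr⟩)
        rw [hf', idxOf_nth hi, idxOf_nth hk'.1]
        exact hlt
      · rintro ⟨k', h1, h2, h3, h4⟩
        have := huniq k' (E.mem_heads.2 ⟨h1.trans hi, h2, h4⟩) h3
        omega
    · refine iff_of_false (fun h => ?_) fun h => h ⟨k, hlt, hk'.2.1, hkr, hk'.2.2⟩
      have h1 := h.2 (G.nth e₀ k) (hT ▸ Finset.mem_image_of_mem _ hk) hkr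
        (by rw [← weight_eq hk'.1]; exact le_antisymm h.1 (weight_antitone hlt.le))
      rw [idxOf_nth hi, idxOf_nth hk'.1] at h1
      omega
  · have hfil : (G.thresholdMatching C S).filter (fun f => f.2 = (G.nth e₀ i).2) = ∅ := by
      rw [hT, Finset.filter_eq_empty_iff]
      intro f hf hfr
      obtain ⟨k, hk, rfl⟩ := Finset.mem_image.1 hf
      exact hex ⟨k, hk, hfr⟩
    refine iff_of_true ⟨?_, fun f hf hfr => ?_⟩ ?_
    · rw [reward, hfil, Finset.sum_empty]
      exact hpos
    · exact absurd (Finset.mem_filter.2 ⟨hf, hfr⟩) (by rw [hfil]; simp)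
    · rintro ⟨k, h1, h2, h3, h4⟩
      exact hex ⟨k, E.mem_heads.2 ⟨h1.trans hi, h2, h4⟩, h3⟩

theorem bestEdge_cond_iff (hl : l ∉ S) (hi : i < G.edges.length) :
    ((G.nth e₀ i).1 = l ∧ G.Survives C S (G.nth e₀ i) ∧ G.MeetsReward C S (G.nth e₀ i)) ↔
      (G.nth e₀ i).1 = l ∧ G.time e₀ i ≤ (stopped e₀ hD C hC).exit S ∧
        ¬ (stopped e₀ hD C hC).Closed (G.nth e₀ i).2 i S := by
  refine and_congr_right fun h => ?_
  rw [survives_iff_time_le (hD := hD) (hC := hC) hi,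
    meetsReward_iff (hD := hD) (hC := hC) hi (h ▸ hl)]

/-- The edge `e⋆` of a left vertex outside of the sample is its accepted edge. -/
theorem bestEdge_eq_some (hl : l ∉ S) {e : Fin n × Fin m} :
    G.bestEdge C S l = some e ↔
      ∃ i, (stopped e₀ hD C hC).Out S i ∧ (G.nth e₀ i).1 = l ∧ G.nth e₀ i = e := by
  classical
  set E := stopped e₀ hD C hC
  have hel : ∀ k, k < G.edges.length → G.Survives C S (G.nth e₀ k) →
      G.MeetsReward C S (G.nth e₀ k) → (G.nth e₀ k).1 = l → E.Out S k ∨ E.Tk S (E.exit S) l k := by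
    intro k hk h1 h2 h3
    obtain ⟨-, h4, h5⟩ := (bestEdge_cond_iff (hD := hD) (hC := hC) hl hk).1 ⟨h3, h1, h2⟩
    by_cases ht : E.Tk S (E.exit S) l k
    · exact Or.inr ht
    · exact Or.inl (acc_iff.2 ⟨h4, fun h => ht (h3 ▸ h), h5⟩)
  have hout : ∀ k, E.Out S k → (G.nth e₀ k).1 = l → k < G.edges.length ∧
      G.Survives C S (G.nth e₀ k) ∧ G.MeetsReward C S (G.nth e₀ k) := by
    intro k hk hkl
    have hk' : k < G.edges.length := hk.lt_size
    exact ⟨hk', ((bestEdge_cond_iff (hD := hD) (hC := hC) hl hk').2 ⟨hkl, hk.tm_le, hk.not_cl⟩).2⟩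
  rw [bestEdge, List.find?_eq_some_iff_getElem]
  constructor
  · rintro ⟨h1, k, hk, rfl, h2⟩
    rw [← nth_eq (e₀ := e₀) hk] at h1 ⊢
    obtain ⟨h3, h4, h5⟩ := of_decide_eq_true h1
    refine ⟨k, (hel k hk h4 h5 h3).resolve_right ?_, h3, rfl⟩
    rintro ⟨p, hp, hpo, hpl⟩
    obtain ⟨h6, h7, h8⟩ := hout p hpo hpl
    have := h2 p hp
    rw [← nth_eq (e₀ := e₀) h6] at this
    simp only [Bool.not_eq_true', decide_eq_false_iff_not] at this
    exact this ⟨hpl, h7, h8⟩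
  · rintro ⟨k, hk, hkl, rfl⟩
    obtain ⟨h6, h7, h8⟩ := hout k hk hkl
    refine ⟨decide_eq_true ⟨hkl, h7, h8⟩, k, h6, (nth_eq h6).symm, fun p hp => ?_⟩
    have hp' := hp.trans h6
    rw [← nth_eq (e₀ := e₀) hp']
    simp only [Bool.not_eq_true', decide_eq_false_iff_not]
    rintro ⟨h1, h2, h3⟩
    rcases hel p hp' h2 h3 h1 with h | h
    · exact hp.ne (h.eq hk (h1.trans hkl.symm))
    · exact hk.not_tk (hkl.symm ▸ h.mono hp.le : E.Tk S (E.exit S) (G.nth e₀ k).1 k)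

theorem subset_arrive (M : Finset (Fin n × Fin m)) (l : Fin n) : M ⊆ G.arrive C S M l := by
  unfold arrive
  split
  · exact subset_rfl
  · rw [addEdge]
    split_ifs
    · exact Finset.subset_insert _ _
    · exact subset_rfl

theorem subset_foldl_arrive (R : List (Fin n)) (M : Finset (Fin n × Fin m)) :
    M ⊆ R.foldl (G.arrive C S) M := by
  induction R generalizing M with
  | nil => exact subset_rfl
  | cons l R ih => exact (subset_arrive M l).trans (ih _)

theorem mem_foldl_arrive {R : List (Fin n)} {M : Finset (Fin n × Fin m)} {e : Fin n × Fin m}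
    (he : e ∈ R.foldl (G.arrive C S) M) :
    e ∈ M ∨ ∃ l ∈ R, G.bestEdge C S l = some e := by
  induction R generalizing M with
  | nil => exact Or.inl he
  | cons l R ih =>
    rcases ih he with h | ⟨l', h1, h2⟩
    · unfold arrive at h
      split at h
      · exact Or.inl h
      · rename_i f hf
        rw [addEdge] at h
        split_ifs at h
        · rcases Finset.mem_insert.1 h with rfl | h
          · exact Or.inr ⟨l, List.mem_cons_self, hf⟩
          · exact Or.inl h
        · exact Or.inl h
    · exact Or.inr ⟨l', List.mem_cons_of_mem _ h1, h2⟩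

/-- Earlier arrivals can contribute only their own best edges, none of which meets the edge `i`; so
it fits when its left vertex arrives, and nothing is ever removed. -/
theorem mem_foldl_of_first {R₁ R₂ : List (Fin n)} (hR : ∀ l ∈ R₁, l ∉ S)
    (hi : (stopped e₀ hD C hC).Out S i) (hiS : (G.nth e₀ i).1 ∉ S)
    (hfirst : ∀ l ∈ R₁, l ≠ (G.nth e₀ i).1 ∧ ∀ k, (stopped e₀ hD C hC).Out S k →
      (G.nth e₀ k).1 = l → (G.nth e₀ k).2 ≠ (G.nth e₀ i).2) :
    G.nth e₀ i ∈ (R₁ ++ (G.nth e₀ i).1 :: R₂).foldl (G.arrive C S) ∅ := by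
  rw [List.foldl_append, List.foldl_cons]
  refine subset_foldl_arrive _ _ ?_
  have hb := (bestEdge_eq_some (hD := hD) (hC := hC) hiS).2 ⟨i, hi, rfl, rfl⟩
  rw [arrive, hb]
  dsimp only
  rw [addEdge, if_pos]
  · exact Finset.mem_insert_self _ _
  · intro f hf
    rcases mem_foldl_arrive hf with h | ⟨l, hl, h⟩
    · simp at h
    · obtain ⟨k, hk, hkl, rfl⟩ := (bestEdge_eq_some (e₀ := e₀) (hD := hD) (hC := hC) (hR l hl)).1 h
      exact ⟨fun h => (hfirst l hl).1 (hkl.symm.trans h), (hfirst l hl).2 k hk hkl⟩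

end Market

/-! ### Uniform samples and random arrival orders -/

namespace Arrival

variable {n : ℕ}

/-- The set of the first `k` arrivals. -/
def sample (π : Equiv.Perm (Fin n)) (k : ℕ) : Finset (Fin n) :=
  Finset.univ.filter fun l => (π.symm l : ℕ) < k

theorem mem_sample {π : Equiv.Perm (Fin n)} {k : ℕ} {l : Fin n} :
    l ∈ sample π k ↔ (π.symm l : ℕ) < k := by
  simp [sample]

theorem toFinset_take (π : Equiv.Perm (Fin n)) (k : ℕ) :
    ((List.ofFn π).take k).toFinset = sample π k := by
  ext l
  rw [List.mem_toFinset, mem_sample, List.mem_take_iff_getElem]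
  constructor
  · rintro ⟨i, hi, rfl⟩
    simp only [List.length_ofFn, lt_min_iff] at hi
    simpa using hi.1
  · intro h
    exact ⟨π.symm l, by simpa using h, by simp⟩

theorem card_sample (π : Equiv.Perm (Fin n)) {k : ℕ} (hk : k ≤ n) : (sample π k).card = k := by
  rw [← toFinset_take, List.toFinset_card_of_nodup, List.length_take, List.length_ofFn,
    min_eq_left hk]
  exact (List.nodup_ofFn.2 π.injective).sublist (List.take_sublist _ _)

/-- The arrival orders in which the vertices of `S` come first. -/
def orders (S : Finset (Fin n)) : Finset (Equiv.Perm (Fin n)) :=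
  Finset.univ.filter fun π => sample π S.card = S

theorem mem_orders {S : Finset (Fin n)} {π : Equiv.Perm (Fin n)} :
    π ∈ orders S ↔ sample π S.card = S := by
  simp [orders]

/-- `l` is the first vertex of `A` to arrive. -/
def First (π : Equiv.Perm (Fin n)) (A : Finset (Fin n)) (l : Fin n) : Prop :=
  l ∈ A ∧ ∀ l' ∈ A, π.symm l ≤ π.symm l'

theorem exists_first (π : Equiv.Perm (Fin n)) {A : Finset (Fin n)} (hA : A.Nonempty) :
    ∃ l, First π A l := by
  obtain ⟨l, hl, h⟩ := A.exists_min_image π.symm hA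
  exact ⟨l, hl, h⟩

theorem First.eq {π : Equiv.Perm (Fin n)} {A : Finset (Fin n)} {l l' : Fin n} (h : First π A l)
    (h' : First π A l') : l = l' :=
  π.symm.injective (le_antisymm (h.2 l' h'.1) (h'.2 l h.1))

open scoped Classical in
-- Composing with the transposition of `l` and `l'` keeps the sample, as both lie outside `S`, and
-- exchanges which of them comes first in `A`.
theorem card_first_le {S A : Finset (Fin n)} (hAS : Disjoint A S) {l l' : Fin n} (hl : l ∈ A)
    (hl' : l' ∈ A) : ((orders S).filter fun π => First π A l).card ≤
      ((orders S).filter fun π => First π A l').card := by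
  have hS : ∀ x ∈ A, x ∉ S := fun x hx => Finset.disjoint_left.1 hAS hx
  refine Finset.card_le_card_of_injOn (fun π => Equiv.swap l l' * π) ?_ ?_
  · intro π hπ
    obtain ⟨h1, h2, h3⟩ := Finset.mem_filter.1 hπ
    rw [mem_orders] at h1
    have hsymm : ∀ x, (Equiv.swap l l' * π).symm x = π.symm (Equiv.swap l l' x) := by
      intro x
      rw [Equiv.symm_apply_eq]
      simp [Equiv.Perm.mul_apply]
    have hmem : ∀ x ∈ A, Equiv.swap l l' x ∈ A := by
      intro x hx
      rw [Equiv.swap_apply_def]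
      split_ifs <;> assumption
    refine Finset.mem_filter.2 ⟨mem_orders.2 ?_, hl', fun x hx => ?_⟩
    · ext x
      rw [mem_sample, hsymm]
      rw [← mem_sample, h1]
      rw [Equiv.swap_apply_def]
      split_ifs with h4 h5
      · subst h4
        exact iff_of_false (hS _ hl') (hS _ hl)
      · subst h5
        exact iff_of_false (hS _ hl) (hS _ hl')
      · rfl
    · rw [hsymm, hsymm, Equiv.swap_apply_right]
      exact h3 _ (hmem x hx)
  · intro π _ π' _ h
    exact mul_left_cancel h

open scoped Classical in
/-- Every vertex of `A` is equally likely to arrive first. -/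
theorem card_first_mul {S A B : Finset (Fin n)} (hAS : Disjoint A S) (hB : B ⊆ A) :
    ((orders S).filter fun π => ∃ l ∈ B, First π A l).card * A.card =
      B.card * (orders S).card := by
  rcases A.eq_empty_or_nonempty with rfl | ⟨a, ha⟩
  · have : B = ∅ := Finset.subset_empty.1 hB
    simp [this]
  have hc : ∀ B ⊆ A, ((orders S).filter fun π => ∃ l ∈ B, First π A l).card =
      B.card * ((orders S).filter fun π => First π A a).card := by
    intro B hB
    have : ((orders S).filter fun π => ∃ l ∈ B, First π A l) =
        B.biUnion fun l => (orders S).filter fun π => First π A l := by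
      ext π
      simp only [Finset.mem_filter, Finset.mem_biUnion]
      constructor
      · rintro ⟨h, l, hl, h'⟩
        exact ⟨l, hl, h, h'⟩
      · rintro ⟨l, hl, h, h'⟩
        exact ⟨h, l, hl, h'⟩
    rw [this, Finset.card_biUnion]
    · rw [Finset.sum_congr rfl fun l hl => le_antisymm (card_first_le hAS (hB hl) ha)
        (card_first_le hAS ha (hB hl)), Finset.sum_const, smul_eq_mul]
    · intro l _ l' _ hne
      rw [Function.onFun, Finset.disjoint_left]
      intro π h h'
      exact hne ((Finset.mem_filter.1 h).2.eq (Finset.mem_filter.1 h').2)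
  have hall : ((orders S).filter fun π => ∃ l ∈ A, First π A l) = orders S := by
    refine Finset.filter_true_of_mem fun π _ => ?_
    obtain ⟨l, hl⟩ := exists_first π ⟨a, ha⟩
    exact ⟨l, hl.1, hl⟩
  have hA := hc A subset_rfl
  rw [hall] at hA
  rw [hc B hB, hA]
  ring

theorem card_orders_le {S T : Finset (Fin n)} (h : S.card = T.card) :
    (orders S).card ≤ (orders T).card := by
  obtain ⟨σ, hσ⟩ : ∃ σ : Equiv.Perm (Fin n), ∀ x, σ x ∈ T ↔ x ∈ S := by
    let f : {x // x ∈ S} ≃ {x // x ∈ T} := Finset.equivOfCardEq h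
    refine ⟨f.extendSubtype, fun x => ?_⟩
    by_cases hx : x ∈ S
    · exact iff_of_true (f.extendSubtype_mem x hx) hx
    · exact iff_of_false (f.extendSubtype_not_mem x hx) hx
  refine Finset.card_le_card_of_injOn (fun π => σ * π) ?_ fun π _ π' _ h => mul_left_cancel h
  intro π hπ
  have hπ := mem_orders.1 hπ
  refine mem_orders.2 ?_
  ext x
  have hsymm : (σ * π).symm x = π.symm (σ.symm x) := by
    rw [Equiv.symm_apply_eq]
    simp [Equiv.Perm.mul_apply]
  rw [mem_sample, hsymm, ← h, ← mem_sample, hπ, ← hσ, Equiv.apply_symm_apply]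

/-- Every set of `k` vertices is equally likely to come first. -/
theorem choose_mul_card_orders (S : Finset (Fin n)) :
    n.choose S.card * (orders S).card = n.factorial := by
  have hS : S.card ≤ n := by simpa using S.card_le_univ
  have h1 : ∑ T ∈ (Finset.univ : Finset (Fin n)).powersetCard S.card, (orders T).card =
      n.factorial := by
    have h2 : (Finset.univ : Finset (Equiv.Perm (Fin n))).card = n.factorial := by
      rw [Finset.card_univ, Fintype.card_perm, Fintype.card_fin]
    rw [← h2, Finset.card_eq_sum_card_fiberwise (f := fun π => sample π S.card)
      (t := Finset.univ.powersetCard S.card)]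
    · refine Finset.sum_congr rfl fun T hT => ?_
      rw [orders, (Finset.mem_powersetCard.1 hT).2]
    · intro π _
      exact Finset.mem_coe.2 (Finset.mem_powersetCard.2 ⟨Finset.subset_univ _, card_sample π hS⟩)
  rw [← h1, Finset.sum_congr rfl fun T hT => le_antisymm
    (card_orders_le (Finset.mem_powersetCard.1 hT).2)
    (card_orders_le (Finset.mem_powersetCard.1 hT).2.symm), Finset.sum_const,
    Finset.card_powersetCard, Finset.card_univ, Fintype.card_fin, smul_eq_mul]

/-- A random arrival order with a binomial sample size is a uniform sample followed by a random
order. -/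
theorem sum_orders (f : Equiv.Perm (Fin n) → ℕ → ℝ) :
    ∑ π : Equiv.Perm (Fin n), ∑ k ∈ Finset.range (n + 1), f π k =
      ∑ S : Finset (Fin n), ∑ π ∈ orders S, f π S.card := by
  have h1 : ∀ k ∈ Finset.range (n + 1), ∑ π : Equiv.Perm (Fin n), f π k =
      ∑ S ∈ (Finset.univ : Finset (Finset (Fin n))).filter (fun S => S.card = k),
        ∑ π ∈ orders S, f π S.card := by
    intro k hk
    have hk : k ≤ n := Nat.lt_succ_iff.1 (Finset.mem_range.1 hk)
    rw [← Finset.sum_fiberwise_of_maps_to (g := fun π => sample π k)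
      (t := (Finset.univ : Finset (Finset (Fin n))).filter (fun S => S.card = k))
      fun π _ => Finset.mem_filter.2 ⟨Finset.mem_univ _, card_sample π hk⟩]
    refine Finset.sum_congr rfl fun S hS => ?_
    obtain rfl := (Finset.mem_filter.1 hS).2
    rfl
  rw [Finset.sum_comm, Finset.sum_congr rfl h1]
  refine Finset.sum_fiberwise_of_maps_to (fun S _ => Finset.mem_range.2 (Nat.lt_succ_of_le ?_)) _
  simpa using S.card_le_univ

end Arrival

/-! ### The probability of matching a right vertex before `j` -/

namespace StoppedEdges

open TimedEdges Arrival

variable {n : ℕ} {β : Type*} [DecidableEq β] (E : StoppedEdges (Fin n) β)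

/-- The left vertices outside of `S` whose edges before `j` are received by `r`. -/
noncomputable def outer (r : β) (j : ℕ) (S : Finset (Fin n)) : Finset (Fin n) :=
  ((E.tails j S).filter fun i => E.rv i = r).image E.lv

variable {E} {S : Finset (Fin n)} {r : β} {j k N : ℕ}

theorem mem_outer {l : Fin n} :
    l ∈ E.outer r j S ↔ ∃ i, i < j ∧ E.Out S i ∧ E.lv i ∉ S ∧ E.rv i = r ∧ E.lv i = l := by
  simp only [outer, Finset.mem_image, Finset.mem_filter, mem_tails]
  constructor
  · rintro ⟨i, ⟨⟨h1, h2, h3⟩, h4⟩, h5⟩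
    exact ⟨i, h1, h2, h3, h4, h5⟩
  · rintro ⟨i, h1, h2, h3, h4, h5⟩
    exact ⟨i, ⟨⟨h1, h2, h3⟩, h4⟩, h5⟩

theorem card_outer : (E.outer r j S).card = ((E.tails j S).filter fun i => E.rv i = r).card :=
  Finset.card_image_of_injOn fun _ hi _ hi' h =>
    (E.mem_tails.1 (Finset.mem_filter.1 hi).1).2.1.eq
      (E.mem_tails.1 (Finset.mem_filter.1 hi').1).2.1 h

theorem outer_mono (h : j ≤ k) : E.outer r j S ⊆ E.outer r k S := fun l hl => by
  rw [mem_outer] at hl ⊢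
  obtain ⟨i, h1, h2⟩ := hl
  exact ⟨i, h1.trans_le h, h2⟩

theorem disjoint_outer : Disjoint (E.outer r j S) S := Finset.disjoint_left.2 fun l hl hS => by
  obtain ⟨i, -, -, h, -, rfl⟩ := mem_outer.1 hl
  exact h hS

theorem card_outer_size (hj : j ≤ E.size) :
    (E.outer r E.size S).card = (E.outer r j S).card + (E.lights r j S).card := by
  classical
  rw [card_outer, card_outer, ← Finset.card_union_of_disjoint]
  · congr 1
    ext i
    simp only [Finset.mem_union, Finset.mem_filter, mem_tails, mem_lights]
    constructor
    · rintro ⟨⟨h1, h2, h3⟩, h4⟩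
      rcases Nat.lt_or_ge i j with h | h
      · exact Or.inl ⟨⟨h, h2, h3⟩, h4⟩
      · exact Or.inr ⟨h, h2, h4, h3⟩
    · rintro (⟨⟨h1, h2, h3⟩, h4⟩ | ⟨h1, h2, h3, h4⟩)
      · exact ⟨⟨h1.trans_le hj, h2, h3⟩, h4⟩
      · exact ⟨⟨h2.lt_size, h2, h4⟩, h3⟩
  · rw [Finset.disjoint_left]
    intro i h h'
    have h1 := (E.mem_tails.1 (Finset.mem_filter.1 h).1).1
    have h2 := (mem_lights.1 h').1
    omega

open scoped Classical in
/-- A lower bound for the probability that the first edge received by `r` comes before `j`. -/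
theorem le_prob_first (hj : j ≤ E.size) :
    (if E.Full r j S then (1 : ℝ) else 0) +
        (if E.Ajar r j S then 1 / (1 + ((E.lights r j S).card : ℝ)) else 0) ≤
      n.choose S.card * ((orders S).filter fun π =>
        ∃ l ∈ E.outer r j S, First π (E.outer r E.size S) l).card / n.factorial := by
  have h1 := card_first_mul (S := S) disjoint_outer (outer_mono (E := E) (r := r) (S := S) hj)
  have h2 := choose_mul_card_orders S
  have h3 := card_outer_size (E := E) (r := r) (S := S) hj
  have hf : (0 : ℝ) < n.factorial := by exact_mod_cast n.factorial_pos
  set X := ((orders S).filter fun π =>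
    ∃ l ∈ E.outer r j S, First π (E.outer r E.size S) l).card
  set B := (E.outer r j S).card with hB
  set κ := (E.lights r j S).card
  have h4 : (X : ℝ) * (B + κ) = B * (orders S).card := by
    rw [h3] at h1
    exact_mod_cast h1
  have h5 : (n.choose S.card : ℝ) * (orders S).card = n.factorial := by exact_mod_cast h2
  have h6 : (n.choose S.card : ℝ) * X * (B + κ) = B * n.factorial := by
    rw [mul_assoc, h4, ← h5]
    ring
  have hκ0 : (0 : ℝ) ≤ κ := Nat.cast_nonneg _
  have hB1 : E.Full r j S ∨ E.Ajar r j S → (1 : ℝ) ≤ B := by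
    intro h
    have : (E.outer r j S).Nonempty := by
      rcases h with ⟨⟨p, hp, hpo, hpr, hpS⟩, i, hi, hr, hiS⟩ | ⟨-, i, hij, hi, hr, hiS⟩
      · have := hpo.le_closing hpS hi (hr.trans hpr.symm)
        exact ⟨_, mem_outer.2 ⟨i, by omega, hi, hiS, hr, rfl⟩⟩
      · exact ⟨_, mem_outer.2 ⟨i, hij, hi, hiS, hr, rfl⟩⟩
    exact_mod_cast this.card_pos
  rw [le_div_iff₀ hf]
  by_cases hF : E.Full r j S
  · have hA : ¬ E.Ajar r j S := fun h => h.1 hF.1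
    rw [if_pos hF, if_neg hA, add_zero, one_mul]
    -- No edge at `r` is accepted after its closing edge, so a full vertex has no rivals after `j`.
    have hκ : κ = 0 := by
      rw [Finset.card_eq_zero, Finset.eq_empty_iff_forall_notMem]
      intro i hi
      obtain ⟨hji, hi, hr, -⟩ := mem_lights.1 hi
      obtain ⟨p, hp, hpo, hpr, hpS⟩ := hF.1
      have := hpo.le_closing hpS hi (hr.trans hpr.symm)
      omega
    have hB1 := hB1 (Or.inl hF)
    rw [hκ, Nat.cast_zero, add_zero, mul_comm (B : ℝ)] at h6
    exact (mul_right_cancel₀ (by linarith) h6).ge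
  · rw [if_neg hF, zero_add]
    by_cases hA : E.Ajar r j S
    · rw [if_pos hA, one_div, inv_mul_le_iff₀ (by linarith)]
      have hB1 := hB1 (Or.inr hA)
      have hpos : (0 : ℝ) < B + κ := by linarith
      have hY : (0 : ℝ) ≤ n.choose S.card * X := by positivity
      refine le_of_mul_le_mul_right ?_ hpos
      rw [mul_assoc, h6]
      -- The probability is `B / (B + κ)`, at least `1 / (1 + κ)` because `B ≥ 1`.
      nlinarith [mul_nonneg (sub_nonneg.2 hB1) hκ0]
    · rw [if_neg hA, zero_mul]
      positivity

end StoppedEdges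

/-! ### Expected value and conclusion -/

namespace Market

open TimedEdges StoppedEdges Arrival

variable {n m : ℕ} {G : Market n m} {e₀ : Fin n × Fin m} {hD : G.DistinctBpb} {C : ℝ} {hC : 0 < C}
  {S : Finset (Fin n)} {i k : ℕ} {π : Equiv.Perm (Fin n)}

theorem onTruth_subset (C : ℝ) (π : Equiv.Perm (Fin n)) (k : ℕ) {e : Fin n × Fin m}
    (he : e ∈ G.onTruth C π k) : e ∈ G.edges := by
  rcases mem_foldl_arrive he with h | ⟨l, -, h⟩
  · simp at h
  · exact List.mem_of_find?_eq_some h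

theorem value_onTruth_nonneg (C : ℝ) (π : Equiv.Perm (Fin n)) (k : ℕ) :
    0 ≤ G.value (G.onTruth C π k) :=
  Finset.sum_nonneg fun e he => (G.v_pos e (onTruth_subset C π k he)).le

theorem expectedValue_nonneg (C : ℝ) : 0 ≤ G.expectedValue C :=
  div_nonneg (Finset.sum_nonneg fun π _ => Finset.sum_nonneg fun k _ =>
    mul_nonneg (by positivity) (value_onTruth_nonneg C π k)) (Nat.cast_nonneg _)

/-- Every right vertex is matched to the first left vertex whose edge it receives. -/
theorem nth_mem_onTruth (hπ : π ∈ orders S) (hi : (stopped e₀ hD C hC).Out S i)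
    (hfirst : First π ((stopped e₀ hD C hC).outer (G.nth e₀ i).2 G.edges.length S)
      (G.nth e₀ i).1) : G.nth e₀ i ∈ G.onTruth C π S.card := by
  have hS := mem_orders.1 hπ
  have hiS : (G.nth e₀ i).1 ∉ S := Finset.disjoint_left.1 disjoint_outer hfirst.1
  have hp : S.card ≤ (π.symm (G.nth e₀ i).1 : ℕ) := by
    rw [← hS, mem_sample] at hiS
    exact not_lt.1 hiS
  rw [onTruth, toFinset_take, hS]
  set p := (π.symm (G.nth e₀ i).1 : ℕ) with hpdef
  have hpn : p < n := (π.symm (G.nth e₀ i).1).2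
  set R := (List.ofFn π).drop S.card with hR
  have hlen : R.length = n - S.card := by simp [hR]
  have hq : p - S.card < R.length := by omega
  have hget : R[p - S.card] = (G.nth e₀ i).1 := by
    simp only [hR, List.getElem_drop, List.getElem_ofFn]
    have : (⟨S.card + (p - S.card), by omega⟩ : Fin n) = π.symm (G.nth e₀ i).1 :=
      Fin.ext (by simp only [← hpdef]; omega)
    rw [this, Equiv.apply_symm_apply]
  rw [← List.take_append_drop (p - S.card) R, List.drop_eq_getElem_cons hq, hget]
  have hbefore : ∀ l ∈ R.take (p - S.card), S.card ≤ (π.symm l : ℕ) ∧ (π.symm l : ℕ) < p := by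
    intro l hl
    obtain ⟨t, ht, rfl⟩ := List.mem_take_iff_getElem.1 hl
    rw [lt_min_iff] at ht
    simp only [hR, List.getElem_drop, List.getElem_ofFn, Equiv.symm_apply_apply]
    omega
  refine mem_foldl_of_first (hD := hD) (hC := hC) (fun l hl => ?_) hi hiS fun l hl => ⟨?_, ?_⟩
  · rw [← hS, mem_sample]
    exact not_lt.2 (hbefore l hl).1
  · rintro rfl
    exact lt_irrefl _ (hbefore _ hl).2
  · intro k hk hkl hkr
    have h1 : l ∈ (stopped e₀ hD C hC).outer (G.nth e₀ i).2 G.edges.length S := by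
      refine mem_outer.2 ⟨k, hk.lt_size, hk, ?_, hkr, hkl⟩
      change (G.nth e₀ k).1 ∉ S
      rw [hkl, ← hS, mem_sample]
      exact not_lt.2 (hbefore l hl).1
    exact absurd (hfirst.2 l h1) (not_le.2 (hbefore l hl).2)

open scoped Classical in
-- Each right vertex keeps the first outside vertex choosing it. Layer by layer, distinct right
-- vertices give distinct edges of the final matching.
theorem le_value_onTruth (e₀ : Fin n × Fin m) (hD : G.DistinctBpb) (hC : 0 < C)
    (hπ : π ∈ orders S) :
    ∑ j ∈ Finset.range G.edges.length, (G.weight j - G.weight (j + 1)) *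
      ∑ r, (if ∃ l ∈ (stopped e₀ hD C hC).outer r (j + 1) S,
        First π ((stopped e₀ hD C hC).outer r G.edges.length S) l then (1 : ℝ) else 0) ≤
      G.value (G.onTruth C π S.card) := by
  set E := stopped e₀ hD C hC with hE
  set I := (E.tails G.edges.length S).filter fun i =>
    First π (E.outer (E.rv i) G.edges.length S) (E.lv i) with hI
  have hlt : ∀ i ∈ I, i < G.edges.length := fun i hi =>
    (E.mem_tails.1 (Finset.mem_filter.1 hi).1).1
  have h1 : ∑ i ∈ I, G.weight i ≤ G.value (G.onTruth C π S.card) := by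
    rw [← sum_image_nth (e₀ := e₀) hlt]
    refine Finset.sum_le_sum_of_subset_of_nonneg (fun e he => ?_)
      fun e he _ => (G.v_pos e (onTruth_subset C π _ he)).le
    obtain ⟨i, hi, rfl⟩ := Finset.mem_image.1 he
    obtain ⟨h2, h3⟩ := Finset.mem_filter.1 hi
    exact nth_mem_onTruth (hD := hD) (hC := hC) hπ (E.mem_tails.1 h2).2.1 h3
  refine le_trans ?_ h1
  rw [Finset.sum_layers weight_length hlt]
  refine Finset.sum_le_sum fun j hj => mul_le_mul_of_nonneg_left ?_
    (sub_nonneg.2 (weight_antitone (Nat.le_succ j)))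
  rw [Finset.sum_boole]
  have h2 : (Finset.univ.filter fun r => ∃ l ∈ E.outer r (j + 1) S,
      First π (E.outer r G.edges.length S) l) ⊆ (I.filter (· < j + 1)).image E.rv := by
    intro r hr
    obtain ⟨l, hl, hfirst⟩ := (Finset.mem_filter.1 hr).2
    obtain ⟨i, hij, hi, hiS, rfl, rfl⟩ := mem_outer.1 hl
    refine Finset.mem_image.2 ⟨i, Finset.mem_filter.2 ⟨Finset.mem_filter.2 ⟨?_, hfirst⟩, hij⟩, rfl⟩
    exact E.mem_tails.2 ⟨hi.lt_size, hi, hiS⟩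
  exact_mod_cast (Finset.card_le_card h2).trans Finset.card_image_le

/-- The expected utility of the algorithm in terms of the average greedy matching. -/
theorem le_expectedValue (e₀ : Fin n × Fin m) (hD : G.DistinctBpb) (hC : 0 < C) :
    (43 / 126) * ((1 / 2) ^ n *
      ∑ S, ∑ i ∈ (stopped e₀ hD C hC).heads G.edges.length S, G.weight i) -
      10 / 63 * G.weight 0 ≤ G.expectedValue C := by
  classical
  set E := stopped e₀ hD C hC with hE
  set N := G.edges.length with hN
  have hf : (0 : ℝ) < n.factorial := by exact_mod_cast n.factorial_pos
  have hΔ : ∀ j, 0 ≤ G.weight j - G.weight (j + 1) := fun j =>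
    sub_nonneg.2 (weight_antitone (Nat.le_succ j))
  have h0 : G.weight 0 = ∑ j ∈ Finset.range N, (G.weight j - G.weight (j + 1)) := by
    rw [Finset.sum_range_sub', weight_length, sub_zero]
  have h1 : G.expectedValue C = (1 / 2) ^ n * ∑ S, ∑ π ∈ orders S,
      (n.choose S.card : ℝ) / n.factorial * G.value (G.onTruth C π S.card) := by
    rw [expectedValue, sum_orders fun π k =>
      (n.choose k : ℝ) * (1 / 2) ^ n * G.value (G.onTruth C π k), Finset.sum_div, Finset.mul_sum]
    refine Finset.sum_congr rfl fun S _ => ?_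
    rw [Finset.sum_div, Finset.mul_sum]
    refine Finset.sum_congr rfl fun π _ => ?_
    ring
  have h2 : ∀ S : Finset (Fin n), ∑ j ∈ Finset.range N, (G.weight j - G.weight (j + 1)) *
      ∑ r, ((if E.Full r (j + 1) S then (1 : ℝ) else 0) +
        (if E.Ajar r (j + 1) S then 1 / (1 + ((E.lights r (j + 1) S).card : ℝ)) else 0)) ≤
      ∑ π ∈ orders S, (n.choose S.card : ℝ) / n.factorial *
        G.value (G.onTruth C π S.card) := by
    intro S
    have h3 : ∑ π ∈ orders S, (n.choose S.card : ℝ) / n.factorial *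
        (∑ j ∈ Finset.range N, (G.weight j - G.weight (j + 1)) *
          ∑ r, (if ∃ l ∈ E.outer r (j + 1) S, First π (E.outer r N S) l then (1 : ℝ) else 0)) ≤
        ∑ π ∈ orders S, (n.choose S.card : ℝ) / n.factorial *
          G.value (G.onTruth C π S.card) :=
      Finset.sum_le_sum fun π hπ =>
        mul_le_mul_of_nonneg_left (le_value_onTruth e₀ hD hC hπ) (by positivity)
    refine le_trans ?_ h3
    rw [← Finset.mul_sum, Finset.sum_comm, Finset.mul_sum]
    refine Finset.sum_le_sum fun j hj => ?_
    rw [← Finset.mul_sum, mul_left_comm]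
    refine mul_le_mul_of_nonneg_left ?_ (hΔ j)
    rw [Finset.sum_comm, Finset.mul_sum]
    refine Finset.sum_le_sum fun r _ => ?_
    refine (le_prob_first (E := E) (r := r) (S := S) (Finset.mem_range.1 hj)).trans (le_of_eq ?_)
    rw [Finset.sum_boole]
    exact (div_mul_eq_mul_div _ _ _).symm
  have h3 : ∑ S, ∑ j ∈ Finset.range N, (G.weight j - G.weight (j + 1)) *
      ∑ r, ((if E.Full r (j + 1) S then (1 : ℝ) else 0) +
        (if E.Ajar r (j + 1) S then 1 / (1 + ((E.lights r (j + 1) S).card : ℝ)) else 0)) =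
      ∑ j ∈ Finset.range N, (G.weight j - G.weight (j + 1)) *
        ∑ r, (((sets (E.Full r (j + 1))).card : ℝ) +
          ∑ W ∈ sets (E.Ajar r (j + 1)), 1 / (1 + ((E.lights r (j + 1) W).card : ℝ))) := by
    rw [Finset.sum_comm]
    refine Finset.sum_congr rfl fun j _ => ?_
    rw [← Finset.mul_sum, Finset.sum_comm]
    congr 1
    refine Finset.sum_congr rfl fun r _ => ?_
    rw [Finset.sum_add_distrib, Finset.sum_boole, sets, sets, Finset.sum_filter]
  have h4 : ∑ j ∈ Finset.range N, (G.weight j - G.weight (j + 1)) *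
      ((43 / 126) * ∑ r, ((sets (E.Closed r (j + 1))).card : ℝ) - 10 / 63 * 2 ^ n) ≤
      ∑ S : Finset (Fin n), ∑ π ∈ orders S, (n.choose S.card : ℝ) / n.factorial *
        G.value (G.onTruth C π S.card) := by
    refine le_trans ?_ ((h3.symm.le).trans (Finset.sum_le_sum fun S _ => h2 S))
    refine Finset.sum_le_sum fun j _ => mul_le_mul_of_nonneg_left ?_ (hΔ j)
    have := E.sum_closed_le (j + 1)
    rwa [Fintype.card_fin] at this
  have h5 : ∑ S, ∑ i ∈ E.heads N S, G.weight i = ∑ j ∈ Finset.range N,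
      (G.weight j - G.weight (j + 1)) * ∑ r, ((sets (E.Closed r (j + 1))).card : ℝ) := by
    have h6 : ∀ S : Finset (Fin n), ∑ i ∈ E.heads N S, G.weight i =
        ∑ j ∈ Finset.range N, (G.weight j - G.weight (j + 1)) * (E.heads (j + 1) S).card :=
      fun S => sum_closings weight_length
    rw [Finset.sum_congr rfl fun S _ => h6 S, Finset.sum_comm]
    refine Finset.sum_congr rfl fun j _ => ?_
    rw [← Finset.mul_sum]
    congr 1
    exact_mod_cast E.card_heads (j + 1)
  have h6 : ∑ j ∈ Finset.range N, (G.weight j - G.weight (j + 1)) *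
      ((43 / 126) * ∑ r, ((sets (E.Closed r (j + 1))).card : ℝ) - 10 / 63 * 2 ^ n) =
      (43 / 126) * ∑ S, ∑ i ∈ E.heads N S, G.weight i - 10 / 63 * 2 ^ n * G.weight 0 := by
    rw [h5, h0, Finset.mul_sum, Finset.mul_sum, ← Finset.sum_sub_distrib]
    refine Finset.sum_congr rfl fun j _ => ?_
    ring
  rw [h6] at h4
  have h7 := mul_le_mul_of_nonneg_left h4 (by positivity : (0 : ℝ) ≤ (1 / 2) ^ n)
  have h8 : ((1 : ℝ) / 2) ^ n * 2 ^ n = 1 := by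
    rw [← mul_pow]
    norm_num
  rw [h1]
  refine le_trans (le_of_eq ?_) h7
  calc _ = (43 / 126) * ((1 / 2) ^ n * ∑ S, ∑ i ∈ E.heads N S, G.weight i) -
        10 / 63 * (((1 : ℝ) / 2) ^ n * 2 ^ n) * G.weight 0 := by rw [h8, mul_one]
    _ = _ := by ring

theorem opt_le_average (e₀ : Fin n × Fin m) (hD : G.DistinctBpb) (hC : 0 < C) :
    G.opt C ≤ 4 * ((1 / 2) ^ n *
      ∑ S, ∑ i ∈ (stopped e₀ hD C hC).heads G.edges.length S, G.weight i) + 2 * G.weight 0 := by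
  set E := stopped e₀ hD C hC
  have h1 := Finset.sum_le_sum fun S (_ : S ∈ (Finset.univ : Finset (Finset (Fin n)))) =>
    opt_le e₀ hD hC S
  rw [Finset.sum_add_distrib, Finset.sum_add_distrib, ← Finset.mul_sum, Finset.sum_const,
    Finset.sum_const, Finset.card_univ, Fintype.card_finset, Fintype.card_fin, nsmul_eq_mul,
    nsmul_eq_mul, Nat.cast_pow, Nat.cast_ofNat] at h1
  have h2 := E.sum_sum_tails_le (N := G.edges.length) (weight_antitone (G := G)) weight_length
  rw [Fintype.card_fin] at h2
  have h8 : ((1 : ℝ) / 2) ^ n * 2 ^ n = 1 := by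
    rw [← mul_pow]
    norm_num
  have h3 : (2 : ℝ) ^ n * G.opt C ≤
      4 * ∑ S, ∑ i ∈ E.heads G.edges.length S, G.weight i + 2 * (2 ^ n * G.weight 0) := by
    linarith
  have h4 := mul_le_mul_of_nonneg_left h3 (by positivity : (0 : ℝ) ≤ (1 / 2) ^ n)
  rw [← mul_assoc, h8, one_mul] at h4
  refine h4.trans (le_of_eq ?_)
  calc _ = 4 * ((1 / 2) ^ n * ∑ S, ∑ i ∈ E.heads G.edges.length S, G.weight i) +
        2 * ((((1 : ℝ) / 2) ^ n * 2 ^ n) * G.weight 0) := by ring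
    _ = _ := by rw [h8, one_mul]

theorem opt_nonpos (h : G.edges = []) (hC : 0 < C) : G.opt C ≤ 0 := by
  refine csSup_le (Set.Nonempty.image _
    ⟨∅, by simp, by simp [IsMatching], by simpa using hC.le⟩) ?_
  rintro _ ⟨M, ⟨hM, -⟩, rfl⟩
  exact Finset.sum_nonpos fun e he => absurd (hM e he) (by simp [h])

end Market

theorem mainTheorem3 :
    ∃ δ : ℝ, 0 < δ ∧
      ∀ (n m : ℕ) (G : Market n m) (C : ℝ), 0 < C → G.DistinctBpb →
        (∀ e ∈ G.edges, G.v e ≤ δ * G.opt C) →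
        G.opt C / 12 ≤ G.expectedValue C := by
  -- Eliminating the mean of heads gives `43/504 · OPT - 83/252 · weight 0`. Since 1/12 = 42/504,
  -- any `δ ≤ 1/166` would do.
  refine ⟨1 / 1000, by norm_num, fun n m G C hC hD hlarge => ?_⟩
  rcases Nat.eq_zero_or_pos G.edges.length with h | h
  · have h1 := Market.opt_nonpos (List.length_eq_zero_iff.1 h) hC
    have h2 := G.expectedValue_nonneg C
    linarith
  · have e₀ := G.edges[0]
    have h1 := Market.le_expectedValue e₀ hD hC
    have h2 := Market.opt_le_average e₀ hD hC
    have h3 : G.weight 0 ≤ 1 / 1000 * G.opt C := by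
      rw [Market.weight_eq (e₀ := e₀) h]
      exact hlarge _ (Market.nth_mem h)
    have h4 := Market.weight_nonneg (G := G) 0
    linarith
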